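/- **Setting.** One source sends samples over one channel. Transmission times $Y_0,Y_1,\dots\ge 0$ are i.i.d. with $0<\mathbb E[Y_i]<\infty$. Sample $i$ is generated at $S_i$, its non-preemptive transmission starts at $G_i$ and it is delivered at $D_i=G_i+Y_i$, where $S_0=G_0=0$, $S_i\le S_{i+1}$, $S_i\le G_i$, $D_i\le G_{i+1}$. A signal-agnostic causal policy $\pi=((S_i,G_i))_{i\ge1}$ takes its decisions from exogenous randomization (independent of the $Y_i$'s) and from the transmission times of the samples delivered so far. The age of information is $\Delta(t)=t-\max\{S_i:D_i\le t\}$ for $t\ge D_0$, and $\Delta(t)=a_0+t$ for $t<D_0$, with some $a_0\ge0$. Let $\Pi_{\mathrm{agnostic}}$ be the set of these policies. Let $p:[0,\infty)\to\mathbb R$ be strictly increasing with $\mathbb E\big[\int_0^{Y_0+Y_1}p(s)\,ds\big]<\infty$ (so that all the expectations below are finite). Consider $$\inf_{\pi\in\Pi_{\mathrm{agnostic}}}\ \limsup_{T\to\infty}\ \mathbb E\Big[\frac1T\int_0^Tp(\Delta(t))\,dt\Big].\qquad(*)$$ **Whittle index.** For $\delta\ge 0$ let $S_0(\delta)=0$,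 $D_i(\delta)=S_i(\delta)+Y_i$, $S_{i+1}(\delta)=D_i(\delta)+\max\{\delta-Y_i,0\}$. The AoI-based Whittle index at age $\delta$ and elapsed service time $\gamma$ is $\alpha(\delta,\gamma)=-\infty$ if $\gamma>0$, and (for any $i$; the value does not depend on $i$) $$\alpha(\delta,0)=\frac1{\mathbb E[Y_i]}\Big\{\mathbb E[D_{i+1}(\delta)-D_i(\delta)]\;\mathbb E[p(\delta+Y_{i+1})]-\mathbb E\Big[\int_{D_i(\delta)}^{D_{i+1}(\delta)}p(s-S_i(\delta))\,ds\Big]\Big\}.$$ Let $\gamma(t)>0$ if a sample is in service at time $t$ (sample $i$ is in service on $[S_i,S_i+Y_i)$ if it is sent at once), and $\gamma(t)=0$ otherwise. **Theorem.** Send every sample at once ($G_i=S_i$) and set $$S_{i+1}=\inf\{t\ge S_i:\ \alpha(\Delta(t),\gamma(t))\ge0\},$$ where $\Delta(t),\gamma(t)$ are the age and the elapsed service time at time $t$ if no sample is taken after sample $i$. Then $(S_1,S_2,\dots)$ is an optimal solution of $(*)$. Moreover, this rule is equivalent to the threshold policy $$S_{i+1}(\beta)=\inf\{t\ge D_i(\beta):\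 \mathbb E[p(t-S_i(\beta)+Y_{i+1})]\ge\beta\},\qquad D_i(\beta)=S_i(\beta)+Y_i,\quad S_0(\beta)=0,$$ in which the expectation is over $Y_{i+1}$ only. Here $\beta$ is the unique root, among the values $\beta$ with $\beta\le\mathbb E[p(\delta+Y_{i+1})]$ for some $\delta\ge0$, of $$\mathbb E\Big[\int_{D_i(\beta)}^{D_{i+1}(\beta)}p(s-S_i(\beta))\,ds\Big]-\beta\,\mathbb E[D_{i+1}(\beta)-D_i(\beta)]=0,$$ and $\beta$ is the optimal value of $(*)$. That is, $\alpha(\delta,0)\ge0$ if and only if $\mathbb E[p(\delta+Y_{i+1})]\ge\beta$, for every $\delta\ge0$, and the two rules generate the same sampling times. -/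

import Mathlib

open MeasureTheory ProbabilityTheory Filter

noncomputable section

namespace AoI

/-- A sampling and scheduling policy of one source: sample `i` is generated at time `S i` and its
transmission over the channel starts at time `G i`.  Sample `0` is the initial one. -/
structure Policy (Ω : Type*) where
  S : ℕ → Ω → ℝ
  G : ℕ → Ω → ℝ

/-- Delivery time of sample `i`: transmission start plus transmission time. -/
def Policy.D {Ω : Type*} (π : Policy Ω) (Y : ℕ → Ω → ℝ) (i : ℕ) (ω : Ω) : ℝ :=
  π.G i ω + Y i ω

/-- What a signal-agnostic scheduler knows once the samples `0, …, i - 1` have been delivered: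
exogenous randomization `R` and the transmission times of these samples. -/
@[reducible] def history {Ω : Type*} (R : MeasurableSpace Ω) (Y : ℕ → Ω → ℝ) (i : ℕ) : MeasurableSpace Ω :=
  R ⊔ ⨆ j : ℕ, ⨆ _ : j < i, MeasurableSpace.comap (Y j) inferInstance

/-- Causal signal-agnostic policies with one non-preemptive channel. -/
structure Admissible {Ω : Type*} (R : MeasurableSpace Ω) (Y : ℕ → Ω → ℝ) (π : Policy Ω) :
    Prop where
  S_zero : ∀ ω, π.S 0 ω = 0
  G_zero : ∀ ω, π.G 0 ω = 0
  S_le_succ : ∀ i ω, π.S i ω ≤ π.S (i + 1) ω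
  S_le_G : ∀ i ω, π.S i ω ≤ π.G i ω
  /-- A transmission starts only after the previous one is completed. -/
  D_le_G : ∀ i ω, π.D Y i ω ≤ π.G (i + 1) ω
  G_causal : ∀ i, Measurable[history R Y i] (π.G i)
  S_meas : ∀ i, Measurable[history R Y i] (π.S i)
  /-- As long as sample `j` is not delivered, the decision whether a later sample `i` has been
  taken by now uses only what was known from the deliveries of the samples before `j`. -/
  S_causal : ∀ i j, j < i → ∀ t : ℝ, ∃ A : Set Ω, MeasurableSet[history R Y j] A ∧
    {ω | π.S i ω ≤ t ∧ t < π.D Y j ω} = A ∩ {ω | t < π.D Y j ω}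

/-- Age of information at time `t`: time since the generation of the freshest delivered sample.
Before the first delivery the age is `a₀ + t`, where `a₀` is the age at time `0`. -/
def age {Ω : Type*} (a₀ : ℝ) (Y : ℕ → Ω → ℝ) (π : Policy Ω) (ω : Ω) (t : ℝ) : ℝ :=
  if t < π.D Y 0 ω then a₀ + t
  else t - sSup {s : ℝ | ∃ i, π.D Y i ω ≤ t ∧ s = π.S i ω}

/-- Long-run average of the expected age penalty.  The expectation for each `T` is that of a
bounded variable; the upper limit may be infinite. -/
def cost {Ω : Type*} [MeasurableSpace Ω] (P : Measure Ω) (p : ℝ → ℝ) (a₀ : ℝ)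
    (Y : ℕ → Ω → ℝ) (π : Policy Ω) : EReal :=
  limsup (fun T : ℝ =>
    ((∫ ω, ((1 / T) * ∫ t in (0 : ℝ)..T, p (age a₀ Y π ω t)) ∂P : ℝ) : EReal)) atTop

/-- `π` is an optimal solution of the age-penalty minimization problem. -/
def IsOptimal {Ω : Type*} (R : MeasurableSpace Ω) [MeasurableSpace Ω] (P : Measure Ω)
    (p : ℝ → ℝ) (a₀ : ℝ) (Y : ℕ → Ω → ℝ) (π : Policy Ω) : Prop :=
  Admissible R Y π ∧ ∀ π' : Policy Ω, Admissible R Y π' → cost P p a₀ Y π ≤ cost P p a₀ Y π'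

/-- The policy that takes samples at the times `S` and transmits each of them at once. -/
def Policy.ofSampling {Ω : Type*} (S : ℕ → Ω → ℝ) : Policy Ω := ⟨S, S⟩

/-- Expected penalty `E[p(δ + X)]`. -/
def meanPenalty {Ω : Type*} [MeasurableSpace Ω] (P : Measure Ω) (p : ℝ → ℝ) (X : Ω → ℝ)
    (δ : ℝ) : ℝ :=
  ∫ ω, p (δ + X ω) ∂P

/-- Expected length `E[D_{k+1} - D_k]` of the `k`-th inter-delivery interval, for the sampling
times `S` and the delivery times `D_i = S_i + Y_i`. -/
def meanLength {Ω : Type*} [MeasurableSpace Ω] (P : Measure Ω) (Y S : ℕ → Ω → ℝ) (k : ℕ) : ℝ :=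
  ∫ ω, ((S (k + 1) ω + Y (k + 1) ω) - (S k ω + Y k ω)) ∂P

/-- Expected penalty accumulated on `[D_k, D_{k+1})`, where the age at time `s` is `s - S_k`. -/
def meanCyclePenalty {Ω : Type*} [MeasurableSpace Ω] (P : Measure Ω) (p : ℝ → ℝ)
    (Y S : ℕ → Ω → ℝ) (k : ℕ) : ℝ :=
  ∫ ω, (∫ s in (S k ω + Y k ω)..(S (k + 1) ω + Y (k + 1) ω), p (s - S k ω)) ∂P

/-- Sampling times when one waits after each delivery until the age is at least `δ`. -/
def waitSampling {Ω : Type*} (Y : ℕ → Ω → ℝ) (δ : ℝ) : ℕ → Ω → ℝ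
  | 0, _ => 0
  | i + 1, ω => waitSampling Y δ i ω + Y i ω + max (δ - Y i ω) 0

/-- The AoI-based Whittle index at age `δ` and elapsed service time `γ`, evaluated on the `k`-th
inter-delivery interval, for weight one. -/
def whittleIndex {Ω : Type*} [MeasurableSpace Ω] (P : Measure Ω) (p : ℝ → ℝ) (Y : ℕ → Ω → ℝ)
    (k : ℕ) (δ γ : ℝ) : EReal :=
  if 0 < γ then ⊥
  else (((1 / ∫ ω, Y k ω ∂P) *
    (meanLength P Y (waitSampling Y δ) k * meanPenalty P p (Y (k + 1)) δ
      - meanCyclePenalty P p Y (waitSampling Y δ) k) : ℝ) : EReal)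

/-- Time already spent at time `t` on a transmission occupying the channel during `[s, s + y)`:
positive while the sample is in service and zero otherwise.  At the instant `s` itself the sample
is already in service; the positive value given there is immaterial. -/
def serviceTime (s y t : ℝ) : ℝ :=
  if s ≤ t ∧ t < s + y then (if t = s then 1 else t - s) else 0

/-- Age at time `t ≥ s` if the last sample was sent at `s`, needs the time `y`, and `u` is the
generation time of the freshest sample delivered before. -/
def currentAge (u s y t : ℝ) : ℝ :=
  if t < s + y then t - u else t - s

/-- The pair `(S_{i-1}, S_i)` of successive sampling times under the Whittle index rule: after
sample `i`, the next sample is taken at the first time at which the index of the current state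
is nonnegative.  By convention `S_{-1} = -a₀`. -/
def whittlePair {Ω : Type*} [MeasurableSpace Ω] (P : Measure Ω) (p : ℝ → ℝ) (a₀ : ℝ)
    (Y : ℕ → Ω → ℝ) (k : ℕ) : ℕ → Ω → ℝ × ℝ
  | 0, _ => (-a₀, 0)
  | i + 1, ω =>
    let u := (whittlePair P p a₀ Y k i ω).1
    let s := (whittlePair P p a₀ Y k i ω).2
    (s, sInf {t : ℝ | s ≤ t ∧
      0 ≤ whittleIndex P p Y k (currentAge u s (Y i ω) t) (serviceTime s (Y i ω) t)})

/-- Sampling times of the Whittle index rule. -/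
def whittleSampling {Ω : Type*} [MeasurableSpace Ω] (P : Measure Ω) (p : ℝ → ℝ) (a₀ : ℝ)
    (Y : ℕ → Ω → ℝ) (k : ℕ) (i : ℕ) (ω : Ω) : ℝ :=
  (whittlePair P p a₀ Y k i ω).2

/-- Sampling times of the threshold rule: after the delivery of sample `i`, the next sample is
taken at the first time at which the expected penalty at its delivery is at least `β`. -/
def thresholdSampling {Ω : Type*} [MeasurableSpace Ω] (P : Measure Ω) (p : ℝ → ℝ)
    (Y : ℕ → Ω → ℝ) (β : ℝ) : ℕ → Ω → ℝ
  | 0, _ => 0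
  | i + 1, ω =>
    sInf {t : ℝ | thresholdSampling P p Y β i ω + Y i ω ≤ t ∧
      β ≤ meanPenalty P p (Y (i + 1)) (t - thresholdSampling P p Y β i ω)}

/-- `β` is a root of the equation that determines the threshold.  The first clause says that the
threshold is reached at some age, so that the threshold rule has finite sampling times. -/
def IsThresholdRoot {Ω : Type*} [MeasurableSpace Ω] (P : Measure Ω) (p : ℝ → ℝ)
    (Y : ℕ → Ω → ℝ) (k : ℕ) (β : ℝ) : Prop :=
  (∃ δ : ℝ, 0 ≤ δ ∧ β ≤ meanPenalty P p (Y (k + 1)) δ) ∧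
  meanCyclePenalty P p Y (thresholdSampling P p Y β) k
    - β * meanLength P Y (thresholdSampling P p Y β) k = 0

end AoI

end

/-! Fix a rate `β` and charge the excess `p(Δ) - β`. Suppose an inter-delivery interval starts at
age `y` and the next transmission starts at age `x ≥ y`. Its duration is independent of the past, so
by Fubini changing `x` from `u` to `v` changes the expected excess by the integral of `E[p(s + Y)] -
β` over `s` from `u` to `v` (`integral_shift_eq`). As `E[p(s + Y)]` increases in `s`, it is best to
start at the first age at which it reaches `β` (`integral_threshold_le`).

Let `H(β)` be the resulting minimal expected excess of a cycle (`thresholdExcess`). It minimizes,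
over waiting ages `δ`, the functions `cyclePenalty δ - β * cycleLength δ`, which are affine in `β`
with negative slope. Comparing minimizers shows that `H` is strictly decreasing and locally
Lipschitz on the reachable rates (`thresholdExcess_sub_le`). It is nonnegative at `p 0` and
nonpositive at the rate of the policy that never waits, so it has exactly one root. The threshold
age for the rate `E[p(δ + Y)]` is `δ` itself, so the numerator of the Whittle index at age `δ` is
`-H(E[p(δ + Y)])`. Its sign therefore decides whether `E[p(δ + Y)] ≥ β` at the root `β`
(`index_nonneg_iff`), and both rules sample at the same times.

For optimality, sum the excess over the cycles that start before a horizon `T`. Generating a sample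
only when its transmission starts, and not waiting past an age where `p ≥ β`, can only lower the
excess; after that the threshold bound applies conditionally on the past
(`setIntegral_threshold_le`). At the root the threshold cycles are centered. The event `D i < T`
depends on `Y i`, which belongs to cycle `i`, so the optional stopping argument is shifted by one
cycle (`abs_sum_setIntegral_le`). What remains is the cycle containing `T`. It is split at a level
`L`: the tail has small mean, and at most order `T` deliveries are expected before `T`, so the error
is `o(T)` (`eventually_error_le`). Hence every admissible policy has cost at least `β` (`le_cost`),
and the threshold policy attains it (`cost_le`). -/

set_option linter.unusedSectionVars false

noncomputable section

namespace AoI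

/-! ### The penalty problem for one inter-delivery interval -/

/-- A nonnegative transmission time law `μ` together with an age penalty `p`, extended to a monotone
function on the whole real line. -/
structure PenaltyModel (μ : Measure ℝ) (p : ℝ → ℝ) : Prop where
  mono : Monotone p
  strict : StrictMonoOn p (Set.Ici 0)
  nonneg : ∀ᵐ y ∂μ, 0 ≤ y
  int_id : Integrable (fun y => y) μ
  mean_pos : 0 < ∫ y, y ∂μ
  int_cycle : Integrable (fun z : ℝ × ℝ => ∫ s in (0 : ℝ)..(z.1 + z.2), p s) (μ.prod μ)

/-- Expected penalty `E[p(δ + Y)]` when `Y` has law `μ`. -/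
def expPenalty (μ : Measure ℝ) (p : ℝ → ℝ) (δ : ℝ) : ℝ := ∫ y, p (δ + y) ∂μ

/-- Expected excess of the penalty over the rate `β` on an inter-delivery interval, when one waits
until the age is at least `δ`. -/
def cycleExcess (μ : Measure ℝ) (p : ℝ → ℝ) (β δ : ℝ) : ℝ :=
  ∫ z : ℝ × ℝ, (∫ s in z.1..(max z.1 δ + z.2), (p s - β)) ∂(μ.prod μ)

/-- Expected penalty accumulated on an inter-delivery interval, when one waits until the age is at
least `δ`. -/
def cyclePenalty (μ : Measure ℝ) (p : ℝ → ℝ) (δ : ℝ) : ℝ :=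
  ∫ z : ℝ × ℝ, (∫ s in z.1..(max z.1 δ + z.2), p s) ∂(μ.prod μ)

/-- Expected length of an inter-delivery interval, when one waits until the age is at
least `δ`. -/
def cycleLength (μ : Measure ℝ) (δ : ℝ) : ℝ :=
  ∫ z : ℝ × ℝ, (max z.1 δ + z.2 - z.1) ∂(μ.prod μ)

/-- The age from which on the expected penalty is at least `β`. -/
def ageThreshold (μ : Measure ℝ) (p : ℝ → ℝ) (β : ℝ) : ℝ :=
  sInf {δ : ℝ | 0 ≤ δ ∧ β ≤ expPenalty μ p δ}

/-! ### Primitives of monotone functions -/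

section Monotone

variable {q : ℝ → ℝ}

theorem _root_.Monotone.sub_const_real (hq : Monotone q) (β : ℝ) :
    Monotone (fun s => q s - β) := fun _ _ h => sub_le_sub_right (hq h) β

theorem intervalIntegrable_abs_of_monotone (hq : Monotone q) (a b : ℝ) :
    IntervalIntegrable (fun s => |q s|) volume a b :=
  (hq.intervalIntegrable (a := a) (b := b)).abs

theorem continuous_integral_of_monotone (hq : Monotone q) :
    Continuous (fun x : ℝ => ∫ s in (0 : ℝ)..x, q s) :=
  intervalIntegral.continuous_primitive (fun _ _ => hq.intervalIntegrable) 0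

theorem continuous_integral_abs_of_monotone (hq : Monotone q) :
    Continuous (fun x : ℝ => ∫ s in (0 : ℝ)..x, |q s|) :=
  intervalIntegral.continuous_primitive (intervalIntegrable_abs_of_monotone hq) 0

theorem integral_eq_sub_of_monotone (hq : Monotone q) (a b : ℝ) :
    ∫ s in a..b, q s = (∫ s in (0 : ℝ)..b, q s) - ∫ s in (0 : ℝ)..a, q s :=
  (intervalIntegral.integral_interval_sub_left hq.intervalIntegrable hq.intervalIntegrable).symm

theorem monotoneOn_integral_abs (hq : Monotone q) {a b : ℝ} (hab : a ≤ b) :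
    ∫ s in (0 : ℝ)..a, |q s| ≤ ∫ s in (0 : ℝ)..b, |q s| := by
  have h := intervalIntegral.integral_interval_sub_left
    (intervalIntegrable_abs_of_monotone hq 0 b) (intervalIntegrable_abs_of_monotone hq 0 a)
  have h2 : 0 ≤ ∫ s in a..b, |q s| :=
    intervalIntegral.integral_nonneg_of_forall hab (fun _ => abs_nonneg _)
  linarith

/-- An integral over a subinterval of `[0, c]` is bounded by the integral of the absolute value. -/
theorem abs_integral_le_of_monotone (hq : Monotone q) {a b c : ℝ} (ha : 0 ≤ a) (hb : 0 ≤ b)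
    (hac : a ≤ c) (hbc : b ≤ c) : |∫ s in a..b, q s| ≤ ∫ s in (0 : ℝ)..c, |q s| := by
  wlog hab : a ≤ b generalizing a b
  · rw [intervalIntegral.integral_symm, abs_neg]
    exact this hb ha hbc hac (le_of_not_ge hab)
  calc |∫ s in a..b, q s| ≤ ∫ s in a..b, |q s| :=
        intervalIntegral.abs_integral_le_integral_abs hab
    _ ≤ ∫ s in (0 : ℝ)..c, |q s| :=
        intervalIntegral.integral_mono_interval ha hab hbc
          (Eventually.of_forall fun _ => abs_nonneg _) (intervalIntegrable_abs_of_monotone hq 0 c)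

end Monotone

/-! ### Integrability of the cycle penalty, and the expected penalty as a function of age -/

namespace PenaltyModel

variable {μ : Measure ℝ} [IsProbabilityMeasure μ] {p : ℝ → ℝ}

theorem nonneg_prod (h : PenaltyModel μ p) :
    ∀ᵐ z ∂(μ.prod μ), 0 ≤ z.1 ∧ 0 ≤ z.2 := by
  have h1 : ∀ᵐ z ∂(μ.prod μ), 0 ≤ z.1 := Measure.quasiMeasurePreserving_fst.ae h.nonneg
  have h2 : ∀ᵐ z ∂(μ.prod μ), 0 ≤ z.2 := Measure.quasiMeasurePreserving_snd.ae h.nonneg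
  filter_upwards [h1, h2] with z a b using ⟨a, b⟩

theorem abs_le_sub (h : PenaltyModel μ p) (β : ℝ) {s : ℝ} (hs : 0 ≤ s) :
    |p s - β| ≤ (p s - p 0) + |p 0 - β| := by
  have := h.mono hs
  calc |p s - β| = |(p s - p 0) + (p 0 - β)| := by ring_nf
    _ ≤ |p s - p 0| + |p 0 - β| := abs_add_le _ _
    _ = _ := by rw [abs_of_nonneg (by linarith)]

theorem integrable_fst (h : PenaltyModel μ p) : Integrable (fun z : ℝ × ℝ => z.1) (μ.prod μ) :=
  h.int_id.comp_fst μ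

theorem integrable_snd (h : PenaltyModel μ p) : Integrable (fun z : ℝ × ℝ => z.2) (μ.prod μ) :=
  h.int_id.comp_snd μ

theorem integrable_integral_sub (h : PenaltyModel μ p) (β : ℝ) :
    Integrable (fun z : ℝ × ℝ => ∫ s in (0 : ℝ)..(z.1 + z.2), (p s - β)) (μ.prod μ) := by
  have h2 : Integrable (fun z : ℝ × ℝ => (z.1 + z.2) * β) (μ.prod μ) :=
    (h.integrable_fst.add h.integrable_snd).mul_const β
  refine (h.int_cycle.sub h2).congr (Eventually.of_forall fun z => ?_)
  simp only [Pi.sub_apply]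
  rw [intervalIntegral.integral_sub h.mono.intervalIntegrable (by simp)]
  simp

theorem integral_abs_le (h : PenaltyModel μ p) (β : ℝ) {x : ℝ} (hx : 0 ≤ x) :
    ∫ s in (0 : ℝ)..x, |p s - β| ≤ (∫ s in (0 : ℝ)..x, (p s - p 0)) + x * |p 0 - β| := by
  have h1 : ∫ s in (0 : ℝ)..x, ((p s - p 0) + |p 0 - β|)
      = (∫ s in (0 : ℝ)..x, (p s - p 0)) + x * |p 0 - β| := by
    rw [intervalIntegral.integral_add (h.mono.sub_const_real _).intervalIntegrable (by simp)]
    simp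
  rw [← h1]
  refine intervalIntegral.integral_mono_on hx
    (intervalIntegrable_abs_of_monotone (h.mono.sub_const_real β) 0 x)
    ((h.mono.sub_const_real _).intervalIntegrable.add (by simp)) fun s hs => ?_
  exact h.abs_le_sub β hs.1

theorem integrable_excess_add (h : PenaltyModel μ p) :
    Integrable (fun z : ℝ × ℝ => ∫ s in (0 : ℝ)..(z.1 + z.2), |p s - p 0|) (μ.prod μ) := by
  refine (h.integrable_integral_sub (p 0)).mono' ?_ ?_
  · exact ((continuous_integral_abs_of_monotone (h.mono.sub_const_real _)).comp
      (by fun_prop)).aestronglyMeasurable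
  · filter_upwards [h.nonneg_prod] with z hz
    have hz0 : 0 ≤ z.1 + z.2 := add_nonneg hz.1 hz.2
    rw [Real.norm_of_nonneg (intervalIntegral.integral_nonneg hz0 fun _ _ => abs_nonneg _)]
    have := h.integral_abs_le (p 0) hz0
    simpa using this

/-- If `Y` exceeds `K` with positive probability, Fubini provides an integrable section of the
two-variable bound at some `x ≥ K`, which dominates. Otherwise `Y < K` almost surely and the
integral is bounded. -/
theorem integrable_excess_const_add (h : PenaltyModel μ p) {K : ℝ} (hK : 0 ≤ K) :
    Integrable (fun y : ℝ => ∫ s in (0 : ℝ)..(K + y), |p s - p 0|) μ := by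
  have hq := h.mono.sub_const_real (p 0)
  have hmeas : AEStronglyMeasurable (fun y : ℝ => ∫ s in (0 : ℝ)..(K + y), |p s - p 0|) μ :=
    ((continuous_integral_abs_of_monotone hq).comp (by fun_prop)).aestronglyMeasurable
  by_cases hpos : μ (Set.Ici K) = 0
  · have hlt : ∀ᵐ y ∂μ, y < K := by
      rw [ae_iff]; simpa [Set.Ici] using hpos
    refine (integrable_const (∫ s in (0 : ℝ)..(K + K), |p s - p 0|)).mono' hmeas ?_
    filter_upwards [hlt, h.nonneg] with y hy hy0
    rw [Real.norm_of_nonneg (intervalIntegral.integral_nonneg (by linarith)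
      fun _ _ => abs_nonneg _)]
    exact monotoneOn_integral_abs hq (by linarith)
  · have hae := h.integrable_excess_add.prod_right_ae
    obtain ⟨x, hx, hxK⟩ : ∃ x, Integrable
        (fun y : ℝ => ∫ s in (0 : ℝ)..(x + y), |p s - p 0|) μ ∧ K ≤ x := by
      by_contra hcon
      push Not at hcon
      refine hpos (measure_mono_null (fun x hx => ?_) (ae_iff.1 hae))
      exact fun hi => absurd (hcon x hi) (not_lt.2 hx)
    refine hx.mono' hmeas ?_
    filter_upwards [h.nonneg] with y hy
    rw [Real.norm_of_nonneg (intervalIntegral.integral_nonneg (by linarith)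
      fun _ _ => abs_nonneg _)]
    exact monotoneOn_integral_abs hq (by linarith)


/-- The bound for everything that happens in one inter-delivery interval is integrable. -/
theorem integrable_integral_abs (h : PenaltyModel μ p) (β : ℝ) {K : ℝ} (hK : 0 ≤ K) :
    Integrable (fun z : ℝ × ℝ => ∫ s in (0 : ℝ)..(max z.1 K + z.2), |p s - β|) (μ.prod μ) := by
  have hq := h.mono.sub_const_real (p 0)
  have h1 := h.integrable_excess_add
  have h2 : Integrable (fun z : ℝ × ℝ => ∫ s in (0 : ℝ)..(K + z.2), |p s - p 0|) (μ.prod μ) :=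
    (h.integrable_excess_const_add hK).comp_snd μ
  have h3 : Integrable (fun z : ℝ × ℝ => (z.1 + K + z.2) * |p 0 - β|) (μ.prod μ) :=
    ((h.integrable_fst.add (integrable_const K)).add h.integrable_snd).mul_const _
  -- The maximum is one of `z.1` and `K`, so the integral up to `max z.1 K + z.2` is at most the sum
  -- of the integrals for both choices; the linear term pays for replacing `p 0` by `β`.
  refine ((h1.add h2).add h3).mono' ?_ ?_
  · exact ((continuous_integral_abs_of_monotone (h.mono.sub_const_real _)).comp
      (by fun_prop)).aestronglyMeasurable
  · filter_upwards [h.nonneg_prod] with z hz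
    have hx : 0 ≤ max z.1 K + z.2 := add_nonneg (le_max_of_le_right hK) hz.2
    rw [Real.norm_of_nonneg (intervalIntegral.integral_nonneg hx fun _ _ => abs_nonneg _)]
    refine (h.integral_abs_le β hx).trans ?_
    simp only [Pi.add_apply]
    have hb : (max z.1 K + z.2) * |p 0 - β| ≤ (z.1 + K + z.2) * |p 0 - β| := by
      gcongr
      exact max_le (by linarith) (by linarith [hz.1])
    refine add_le_add ?_ hb
    have hle : ∀ x : ℝ, 0 ≤ x → ∫ s in (0 : ℝ)..x, (p s - p 0) = ∫ s in (0 : ℝ)..x, |p s - p 0| := by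
      intro x hx
      refine intervalIntegral.integral_congr fun s hs => ?_
      rw [Set.uIcc_of_le hx] at hs
      exact (abs_of_nonneg (by linarith [h.mono hs.1])).symm
    rw [hle _ hx]
    have n1 : 0 ≤ ∫ s in (0 : ℝ)..(z.1 + z.2), |p s - p 0| :=
      intervalIntegral.integral_nonneg (add_nonneg hz.1 hz.2) fun _ _ => abs_nonneg _
    have n2 : 0 ≤ ∫ s in (0 : ℝ)..(K + z.2), |p s - p 0| :=
      intervalIntegral.integral_nonneg (add_nonneg hK hz.2) fun _ _ => abs_nonneg _
    rcases max_choice z.1 K with hm | hm <;> rw [hm] <;> linarith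

/-- By monotonicity, `p (δ + y) - p 0` is at most the integral of `p - p 0` over the unit interval
to the right of `δ + y`, and this is dominated by the integrable bound for `K = δ + 1`. -/
theorem integrable_shift (h : PenaltyModel μ p) {δ : ℝ} (hδ : 0 ≤ δ) :
    Integrable (fun y => p (δ + y)) μ := by
  have hint := h.integrable_excess_const_add (K := δ + 1) (by linarith)
  refine (hint.add (integrable_const |p 0|)).mono' ?_ ?_
  · exact (h.mono.measurable.comp (measurable_const_add δ)).aestronglyMeasurable
  · filter_upwards [h.nonneg] with y hy
    have h0 : p 0 ≤ p (δ + y) := h.mono (by linarith)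
    have h1 : ∫ s in (δ + y)..(δ + 1 + y), (p (δ + y) - p 0)
        ≤ ∫ s in (δ + y)..(δ + 1 + y), |p s - p 0| := by
      refine intervalIntegral.integral_mono_on (by linarith) (by simp)
        (intervalIntegrable_abs_of_monotone (h.mono.sub_const_real _) _ _) fun s hs => ?_
      exact (sub_le_sub_right (h.mono hs.1) _).trans (le_abs_self _)
    have h2 : ∫ s in (δ + y)..(δ + 1 + y), |p s - p 0| ≤ ∫ s in (0 : ℝ)..(δ + 1 + y), |p s - p 0| :=
      intervalIntegral.integral_mono_interval (by linarith) (by linarith) le_rfl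
        (Eventually.of_forall fun _ => abs_nonneg _)
        (intervalIntegrable_abs_of_monotone (h.mono.sub_const_real _) _ _)
    rw [intervalIntegral.integral_const] at h1
    simp only [Pi.add_apply, Real.norm_eq_abs]
    have h3 : |p (δ + y)| ≤ (p (δ + y) - p 0) + |p 0| := by
      simpa using h.abs_le_sub 0 (s := δ + y) (by linarith)
    have h4 : (δ + 1 + y - (δ + y)) • (p (δ + y) - p 0) = p (δ + y) - p 0 := by
      rw [smul_eq_mul]; ring
    linarith

theorem expPenalty_mono (h : PenaltyModel μ p) {a b : ℝ} (ha : 0 ≤ a) (hab : a ≤ b) :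
    expPenalty μ p a ≤ expPenalty μ p b :=
  integral_mono (h.integrable_shift ha) (h.integrable_shift (ha.trans hab))
    fun _ => h.mono (by linarith)

theorem integral_lt_integral_of_ae_lt {f g : ℝ → ℝ} (hf : Integrable f μ) (hg : Integrable g μ)
    (hfg : ∀ᵐ y ∂μ, f y < g y) : ∫ y, f y ∂μ < ∫ y, g y ∂μ := by
  refine lt_of_le_of_ne (integral_mono_ae hf hg (hfg.mono fun _ h => h.le)) fun heq => ?_
  have h0 := (integral_eq_iff_of_ae_le hf hg (hfg.mono fun _ h => h.le)).1 heq
  have : ∀ᵐ y ∂μ, False := by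
    filter_upwards [hfg, h0] with y h1 h2
    exact h1.ne h2
  exact this.exists.elim fun _ hF => hF

theorem expPenalty_strict (h : PenaltyModel μ p) {a b : ℝ} (ha : 0 ≤ a) (hab : a < b) :
    expPenalty μ p a < expPenalty μ p b := by
  refine integral_lt_integral_of_ae_lt (h.integrable_shift ha)
    (h.integrable_shift (ha.trans hab.le)) ?_
  filter_upwards [h.nonneg] with y hy
  exact h.strict (show (0 : ℝ) ≤ a + y by linarith) (show (0 : ℝ) ≤ b + y by linarith)
    (by linarith)

theorem le_expPenalty (h : PenaltyModel μ p) {s : ℝ} (hs : 0 ≤ s) : p s ≤ expPenalty μ p s := by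
  have h1 : ∫ _ : ℝ, p s ∂μ ≤ expPenalty μ p s := by
    refine integral_mono_ae (integrable_const _) (h.integrable_shift hs) ?_
    filter_upwards [h.nonneg] with y hy
    exact h.mono (by linarith)
  simpa using h1

/-- An average cannot reach `β` if all values lie below `β`. This yields the age beyond which
waiting is never profitable. -/
theorem exists_le_penalty (h : PenaltyModel μ p) {β δ : ℝ} (hδ : 0 ≤ δ)
    (hβ : β ≤ expPenalty μ p δ) : ∃ s, 0 ≤ s ∧ β ≤ p s := by
  by_contra hcon
  push Not at hcon
  have h1 : expPenalty μ p δ < ∫ _ : ℝ, β ∂μ := by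
    refine integral_lt_integral_of_ae_lt (h.integrable_shift hδ) (integrable_const _) ?_
    filter_upwards [h.nonneg] with y hy
    exact hcon _ (by linarith)
  simp at h1
  linarith

/-! ### The threshold age -/

variable {β : ℝ}

theorem ageThreshold_nonneg : 0 ≤ ageThreshold μ p β := Real.sInf_nonneg fun _ h => h.1

theorem bddBelow_ageThreshold : BddBelow {δ : ℝ | 0 ≤ δ ∧ β ≤ expPenalty μ p δ} :=
  ⟨0, fun _ h => h.1⟩

theorem ageThreshold_le {δ : ℝ} (hδ : 0 ≤ δ) (hβ : β ≤ expPenalty μ p δ) :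
    ageThreshold μ p β ≤ δ := csInf_le bddBelow_ageThreshold ⟨hδ, hβ⟩

theorem lt_of_lt_ageThreshold {δ : ℝ} (hδ : 0 ≤ δ) (hlt : δ < ageThreshold μ p β) :
    expPenalty μ p δ < β := by
  by_contra hcon
  exact absurd (ageThreshold_le hδ (not_lt.1 hcon)) (not_le.2 hlt)

theorem le_of_ageThreshold_lt (h : PenaltyModel μ p) (hβ : ∃ δ, 0 ≤ δ ∧ β ≤ expPenalty μ p δ)
    {δ : ℝ} (hlt : ageThreshold μ p β < δ) : β ≤ expPenalty μ p δ := by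
  obtain ⟨d, hd, hdδ⟩ := exists_lt_of_csInf_lt hβ hlt
  exact hd.2.trans (h.expPenalty_mono hd.1 hdδ.le)

/-- Strict monotonicity excludes any smaller age. This identity lets the index at age `δ` be read as
a threshold problem. -/
theorem ageThreshold_expPenalty (h : PenaltyModel μ p) {δ : ℝ} (hδ : 0 ≤ δ) :
    ageThreshold μ p (expPenalty μ p δ) = δ := by
  refine le_antisymm (ageThreshold_le hδ le_rfl) (le_csInf ⟨δ, hδ, le_rfl⟩ fun d hd => ?_)
  by_contra hcon
  exact absurd (h.expPenalty_strict hd.1 (not_le.1 hcon)) (not_lt.2 hd.2)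

theorem ageThreshold_mono {b : ℝ} (hb : ∃ δ, 0 ≤ δ ∧ b ≤ expPenalty μ p δ)
    (hβb : β ≤ b) : ageThreshold μ p β ≤ ageThreshold μ p b :=
  csInf_le_csInf bddBelow_ageThreshold hb fun _ hd => ⟨hd.1, hβb.trans hd.2⟩

/-- After translating by `y`, this is Fubini on a bounded age interval. It turns a choice between
two sampling ages into the integral of a function of one sign on each side of the threshold. -/
theorem integral_shift_eq (h : PenaltyModel μ p) (β : ℝ) {u v : ℝ} (hu : 0 ≤ u) (hv : 0 ≤ v) :
    ∫ y, (∫ s in (u + y)..(v + y), (p s - β)) ∂μ = ∫ s in u..v, (expPenalty μ p s - β) := by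
  have hmeas : Measurable (Function.uncurry fun s y : ℝ => p (s + y) - β) :=
    (h.mono.measurable.comp (measurable_fst.add measurable_snd)).sub_const β
  have hint : Integrable (Function.uncurry fun s y : ℝ => p (s + y) - β)
      ((volume.restrict (Set.uIoc u v)).prod μ) := by
    have hb : Integrable (fun z : ℝ × ℝ => (p (max u v + z.2) - p 0) + |p 0 - β|)
        ((volume.restrict (Set.uIoc u v)).prod μ) := by
      have : IsFiniteMeasure (volume.restrict (Set.uIoc u v)) := by
        rw [Set.uIoc]; infer_instance
      exact (((h.integrable_shift (le_max_of_le_left hu)).sub (integrable_const (p 0))).add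
        (integrable_const _)).comp_snd _
    refine hb.mono' hmeas.aestronglyMeasurable ?_
    have h1 : ∀ᵐ z ∂((volume.restrict (Set.uIoc u v)).prod μ), z.1 ∈ Set.uIoc u v :=
      Measure.quasiMeasurePreserving_fst.ae (ae_restrict_mem measurableSet_uIoc)
    have h2 : ∀ᵐ z ∂((volume.restrict (Set.uIoc u v)).prod μ), 0 ≤ z.2 :=
      Measure.quasiMeasurePreserving_snd.ae h.nonneg
    filter_upwards [h1, h2] with z hz1 hz2
    rw [Set.uIoc, Set.mem_Ioc] at hz1
    have hz0 : 0 ≤ z.1 := (le_min hu hv).trans hz1.1.le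
    refine (h.abs_le_sub β (s := z.1 + z.2) (by linarith)).trans ?_
    have := h.mono (show z.1 + z.2 ≤ max u v + z.2 by linarith [hz1.2])
    linarith
  have hsw := intervalIntegral_integral_swap hint
  calc ∫ y, (∫ s in (u + y)..(v + y), (p s - β)) ∂μ
      = ∫ y, (∫ s in u..v, (p (s + y) - β)) ∂μ := by
        refine integral_congr_ae (Eventually.of_forall fun y => ?_)
        exact (intervalIntegral.integral_comp_add_right (fun s => p s - β) y).symm
    _ = ∫ s in u..v, (∫ y, (p (s + y) - β) ∂μ) := hsw.symm
    _ = ∫ s in u..v, (expPenalty μ p s - β) := by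
        refine intervalIntegral.integral_congr fun s hs => ?_
        have hs0 : 0 ≤ s := (le_min hu hv).trans hs.1
        rw [integral_sub (h.integrable_shift hs0) (integrable_const _)]
        simp [expPenalty]

/-- Sampling when the age reaches the threshold is the best way to end an interval that started
at age `y`. -/
theorem integral_threshold_le (h : PenaltyModel μ p) (hβ : ∃ δ, 0 ≤ δ ∧ β ≤ expPenalty μ p δ)
    {x y : ℝ} (hy : 0 ≤ y) (hyx : y ≤ x) :
    0 ≤ ∫ w, (∫ s in (max y (ageThreshold μ p β) + w)..(x + w), (p s - β)) ∂μ := by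
  have hu : 0 ≤ max y (ageThreshold μ p β) := le_max_of_le_left hy
  rw [h.integral_shift_eq β hu (hy.trans hyx)]
  -- Starting too late adds a stretch where the integrand is nonnegative; starting too early omits
  -- one where it is nonpositive.
  rcases le_total (max y (ageThreshold μ p β)) x with hx | hx
  · rw [intervalIntegral.integral_of_le hx]
    refine setIntegral_nonneg measurableSet_Ioc fun s hs => sub_nonneg.2 ?_
    exact h.le_of_ageThreshold_lt hβ ((le_max_right _ _).trans_lt hs.1)
  · rw [intervalIntegral.integral_symm, neg_nonneg, intervalIntegral.integral_of_le hx,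
      integral_Ioc_eq_integral_Ioo]
    refine setIntegral_nonpos measurableSet_Ioo fun s hs => sub_nonpos.2 ?_
    refine (lt_of_lt_ageThreshold ((hy.trans hyx).trans hs.1.le) ?_).le
    -- Since `y ≤ x < s`, only the threshold branch of the maximum can exceed `s`.
    rcases lt_max_iff.1 hs.2 with h1 | h1
    · linarith [hs.1]
    · exact h1

/-! ### The equation for the threshold -/

theorem measurable_integral_interval (h : PenaltyModel μ p) (β : ℝ) {α : Type*}
    [MeasurableSpace α] {f g : α → ℝ} (hf : Measurable f) (hg : Measurable g) :
    Measurable fun z => ∫ s in (f z)..(g z), (p s - β) := by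
  have hc := (continuous_integral_of_monotone (h.mono.sub_const_real β)).measurable
  convert (hc.comp hg).sub (hc.comp hf) using 2 with z
  exact integral_eq_sub_of_monotone (h.mono.sub_const_real β) (f z) (g z)

theorem integrable_cycleExcess (h : PenaltyModel μ p) (β : ℝ) {δ : ℝ} (hδ : 0 ≤ δ) :
    Integrable (fun z : ℝ × ℝ => ∫ s in z.1..(max z.1 δ + z.2), (p s - β)) (μ.prod μ) := by
  refine (h.integrable_integral_abs β hδ).mono' ?_ ?_
  · exact (h.measurable_integral_interval β (by fun_prop) (by fun_prop)).aestronglyMeasurable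
  · filter_upwards [h.nonneg_prod] with z hz
    have h1 : z.1 ≤ max z.1 δ + z.2 := by linarith [le_max_left z.1 δ, hz.2]
    exact abs_integral_le_of_monotone (h.mono.sub_const_real β) hz.1 (hz.1.trans h1) h1 le_rfl

theorem integrable_cycleLength (h : PenaltyModel μ p) (δ : ℝ) :
    Integrable (fun z : ℝ × ℝ => max z.1 δ + z.2 - z.1) (μ.prod μ) :=
  ((h.integrable_fst.sup (integrable_const δ)).add h.integrable_snd).sub h.integrable_fst

theorem cycleExcess_eq (h : PenaltyModel μ p) (β : ℝ) {δ : ℝ} (hδ : 0 ≤ δ) :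
    cycleExcess μ p β δ = cyclePenalty μ p δ - β * cycleLength μ δ := by
  have h0 : Integrable (fun z : ℝ × ℝ => ∫ s in z.1..(max z.1 δ + z.2), p s) (μ.prod μ) := by
    simpa using h.integrable_cycleExcess 0 hδ
  rw [cyclePenalty, cycleLength, ← integral_const_mul, ← integral_sub h0
    ((h.integrable_cycleLength δ).const_mul β)]
  refine integral_congr_ae (Eventually.of_forall fun z => ?_)
  simp only
  rw [intervalIntegral.integral_sub h.mono.intervalIntegrable (by simp)]
  simp [mul_comm]

theorem integral_snd_eq : ∫ z : ℝ × ℝ, z.2 ∂(μ.prod μ) = ∫ y, y ∂μ := by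
  have := integral_fun_snd (μ := μ) (ν := μ) (fun y : ℝ => y)
  simpa using this

theorem mean_le_cycleLength (h : PenaltyModel μ p) (δ : ℝ) : ∫ y, y ∂μ ≤ cycleLength μ δ := by
  rw [← integral_snd_eq]
  refine integral_mono h.integrable_snd (h.integrable_cycleLength δ) fun z => ?_
  have := le_max_left z.1 δ
  simp only; linarith

theorem cycleLength_pos (h : PenaltyModel μ p) (δ : ℝ) : 0 < cycleLength μ δ :=
  h.mean_pos.trans_le (h.mean_le_cycleLength δ)

theorem cycleLength_mono (h : PenaltyModel μ p) {a b : ℝ} (hab : a ≤ b) :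
    cycleLength μ a ≤ cycleLength μ b := by
  refine integral_mono (h.integrable_cycleLength a) (h.integrable_cycleLength b) fun z => ?_
  have := max_le_max_left z.1 hab
  simp only; linarith

/-- Waiting for the threshold age minimizes the expected excess. -/
theorem cycleExcess_threshold_le (h : PenaltyModel μ p)
    (hβ : ∃ δ, 0 ≤ δ ∧ β ≤ expPenalty μ p δ) {δ : ℝ} (hδ : 0 ≤ δ) :
    cycleExcess μ p β (ageThreshold μ p β) ≤ cycleExcess μ p β δ := by
  have hd : 0 ≤ ageThreshold μ p β := ageThreshold_nonneg
  have i1 := h.integrable_cycleExcess β hδ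
  have i2 := h.integrable_cycleExcess β hd
  rw [← sub_nonneg, cycleExcess, cycleExcess, ← integral_sub i1 i2]
  -- Conditioning on the age at the start of the interval reduces the claim to the one-interval
  -- comparison with `x = max y δ`.
  refine le_of_le_of_eq ?_ (integral_prod _ (i1.sub i2)).symm
  refine integral_nonneg_of_ae ?_
  filter_upwards [h.nonneg] with y hy
  have := h.integral_threshold_le hβ hy (le_max_left y δ)
  refine this.trans_eq (integral_congr_ae (Eventually.of_forall fun w => ?_))
  refine (intervalIntegral.integral_interval_sub_left ?_ ?_).symm <;>
    exact (h.mono.sub_const_real β).intervalIntegrable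

/-- The expected excess over the rate `β` under the threshold rule for `β`. -/
def _root_.AoI.thresholdExcess (μ : Measure ℝ) (p : ℝ → ℝ) (β : ℝ) : ℝ :=
  cycleExcess μ p β (ageThreshold μ p β)

/-- The threshold for `b` is a competitor in the problem for `β`, and the excess of a fixed waiting
rule is affine in the rate with slope minus its cycle length. Strict monotonicity, continuity and
uniqueness of the root all follow from this inequality. -/
theorem thresholdExcess_sub_le (h : PenaltyModel μ p)
    (hβ : ∃ δ, 0 ≤ δ ∧ β ≤ expPenalty μ p δ) (b : ℝ) :
    thresholdExcess μ p β - thresholdExcess μ p b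
      ≤ (b - β) * cycleLength μ (ageThreshold μ p b) := by
  have hd : 0 ≤ ageThreshold μ p b := ageThreshold_nonneg
  have h1 := h.cycleExcess_threshold_le hβ hd
  rw [thresholdExcess, thresholdExcess]
  rw [h.cycleExcess_eq β hd] at h1
  rw [h.cycleExcess_eq b hd]
  linarith

theorem thresholdExcess_strictAnti (h : PenaltyModel μ p) {b : ℝ}
    (hb : ∃ δ, 0 ≤ δ ∧ b ≤ expPenalty μ p δ) (hlt : β < b) :
    thresholdExcess μ p b < thresholdExcess μ p β := by
  have := h.thresholdExcess_sub_le hb β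
  have := mul_pos (sub_pos.2 hlt) (h.cycleLength_pos (ageThreshold μ p β))
  nlinarith

theorem thresholdExcess_antitone (h : PenaltyModel μ p) {b : ℝ}
    (hb : ∃ δ, 0 ≤ δ ∧ b ≤ expPenalty μ p δ) (hle : β ≤ b) :
    thresholdExcess μ p b ≤ thresholdExcess μ p β := by
  rcases hle.eq_or_lt with rfl | hlt
  · exact le_rfl
  · exact (h.thresholdExcess_strictAnti hb hlt).le

theorem reachable_of_le {b : ℝ} (hb : ∃ δ, 0 ≤ δ ∧ b ≤ expPenalty μ p δ) (hle : β ≤ b) :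
    ∃ δ, 0 ≤ δ ∧ β ≤ expPenalty μ p δ :=
  hb.imp fun _ hd => ⟨hd.1, hle.trans hd.2⟩

theorem continuousOn_thresholdExcess (h : PenaltyModel μ p) {a b : ℝ}
    (hb : ∃ δ, 0 ≤ δ ∧ b ≤ expPenalty μ p δ) :
    ContinuousOn (thresholdExcess μ p) (Set.Icc a b) := by
  have hL := h.cycleLength_pos (ageThreshold μ p b)
  -- Threshold ages increase with the rate, so the cycle length at `b` bounds all those on the
  -- interval and serves as Lipschitz constant.
  refine (LipschitzOnWith.of_le_add_mul (K := (cycleLength μ (ageThreshold μ p b)).toNNReal)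
    (f := thresholdExcess μ p) fun x hx y hy => ?_).continuousOn
  rw [Real.coe_toNNReal _ hL.le, Real.dist_eq]
  have h1 := h.thresholdExcess_sub_le (reachable_of_le hb hx.2) y
  have hy0 := h.cycleLength_pos (ageThreshold μ p y)
  have hyb := h.cycleLength_mono (ageThreshold_mono hb hy.2)
  have h2 : (y - x) * cycleLength μ (ageThreshold μ p y)
      ≤ cycleLength μ (ageThreshold μ p b) * |x - y| := by
    rw [abs_sub_comm, mul_comm (cycleLength _ _)]
    exact mul_le_mul (le_abs_self _) hyb hy0.le (abs_nonneg _)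
  linarith

/-- The rate of the policy that never waits is attained by the expected penalty. -/
theorem exists_rate_le_expPenalty (h : PenaltyModel μ p) :
    ∃ δ, 0 ≤ δ ∧ cyclePenalty μ p 0 / cycleLength μ 0 ≤ expPenalty μ p δ := by
  set b := cyclePenalty μ p 0 / cycleLength μ 0 with hb
  by_contra hcon
  push Not at hcon
  -- As `p s ≤ E[p(s + Y)]`, the penalty itself stays below `b`. Then never waiting has negative
  -- excess in every cycle of positive service time, whereas its mean excess at its own rate is
  -- zero; this would force `Y = 0` almost surely.
  have hlt : ∀ s, 0 ≤ s → p s < b := fun s hs => (h.le_expPenalty hs).trans_lt (hcon s hs)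
  have h0 : cycleExcess μ p b 0 = 0 := by
    rw [h.cycleExcess_eq b le_rfl, hb, div_mul_cancel₀ _ (h.cycleLength_pos 0).ne', sub_self]
  have hmono := h.mono.sub_const_real b
  have hneg : ∀ z : ℝ × ℝ, 0 ≤ z.1 → 0 < z.2 →
      ∫ s in z.1..(max z.1 0 + z.2), (p s - b) < 0 := by
    intro z h1 h2
    rw [max_eq_left h1, ← neg_pos, ← intervalIntegral.integral_neg]
    refine intervalIntegral.intervalIntegral_pos_of_pos_on
      hmono.intervalIntegrable.neg (fun s hs => ?_) (by linarith)
    linarith [hlt s (h1.trans hs.1.le)]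
  have hle : (fun z : ℝ × ℝ => ∫ s in z.1..(max z.1 0 + z.2), (p s - b)) ≤ᵐ[μ.prod μ] 0 := by
    filter_upwards [h.nonneg_prod] with z hz
    rcases hz.2.eq_or_lt with h2 | h2
    · simp [← h2, max_eq_left hz.1]
    · exact (hneg z hz.1 h2).le
  have hz := (integral_eq_iff_of_ae_le (h.integrable_cycleExcess b le_rfl)
    (integrable_zero _ _ _) hle).1 (by simpa [cycleExcess] using h0)
  have h2 : (fun z : ℝ × ℝ => z.2) =ᵐ[μ.prod μ] 0 := by
    filter_upwards [h.nonneg_prod, hz] with z hz1 hz2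
    by_contra hne
    exact absurd hz2 (hneg z hz1.1 (lt_of_le_of_ne hz1.2 (Ne.symm hne))).ne
  have := h.mean_pos
  rw [← integral_snd_eq, integral_congr_ae h2] at this
  simp at this

/-- The threshold equation has a solution. -/
theorem exists_thresholdExcess_eq_zero (h : PenaltyModel μ p) :
    ∃ β, (∃ δ, 0 ≤ δ ∧ β ≤ expPenalty μ p δ) ∧ thresholdExcess μ p β = 0 := by
  set b := cyclePenalty μ p 0 / cycleLength μ 0 with hb
  have hreach := h.exists_rate_le_expPenalty
  have hnonneg : ∀ δ, 0 ≤ δ → 0 ≤ cycleExcess μ p (p 0) δ := by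
    intro δ hδ
    refine integral_nonneg_of_ae ?_
    filter_upwards [h.nonneg_prod] with z hz
    refine intervalIntegral.integral_nonneg ?_ fun s hs => ?_
    · linarith [le_max_left z.1 δ, hz.2]
    · linarith [h.mono (hz.1.trans hs.1)]
  have hL := h.cycleLength_pos 0
  have hle : p 0 ≤ b := by
    have := hnonneg 0 le_rfl
    rw [h.cycleExcess_eq _ le_rfl] at this
    rw [hb, le_div_iff₀ hL]
    linarith
  have h1 : thresholdExcess μ p b ≤ 0 := by
    refine (h.cycleExcess_threshold_le hreach le_rfl).trans ?_
    rw [h.cycleExcess_eq b le_rfl, hb, div_mul_cancel₀ _ hL.ne', sub_self]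
  -- At rate `p 0` no cycle has negative excess. At the rate of never waiting, the threshold rule
  -- does no worse than waiting for age `0`, whose excess vanishes.
  obtain ⟨β, hβ, h0⟩ := intermediate_value_Icc' hle (h.continuousOn_thresholdExcess hreach)
    ⟨h1, hnonneg _ ageThreshold_nonneg⟩
  exact ⟨β, reachable_of_le hreach hβ.2, h0⟩

theorem thresholdExcess_root_unique (h : PenaltyModel μ p) {b : ℝ}
    (hβ : ∃ δ, 0 ≤ δ ∧ β ≤ expPenalty μ p δ) (hb : ∃ δ, 0 ≤ δ ∧ b ≤ expPenalty μ p δ)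
    (hβ0 : thresholdExcess μ p β = 0) (hb0 : thresholdExcess μ p b = 0) : b = β := by
  rcases lt_trichotomy b β with hlt | heq | hlt
  · linarith [h.thresholdExcess_strictAnti hβ hlt]
  · exact heq
  · linarith [h.thresholdExcess_strictAnti hb hlt]

/-- The numerator of the Whittle index is nonnegative exactly beyond the threshold. -/
theorem index_nonneg_iff (h : PenaltyModel μ p) (hβ : ∃ δ, 0 ≤ δ ∧ β ≤ expPenalty μ p δ)
    (hβ0 : thresholdExcess μ p β = 0) {δ : ℝ} (hδ : 0 ≤ δ) :
    0 ≤ cycleLength μ δ * expPenalty μ p δ - cyclePenalty μ p δ ↔ β ≤ expPenalty μ p δ := by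
  -- At this rate the threshold age is exactly `δ`, so the index numerator is minus the threshold
  -- excess, and strict monotonicity in the rate finishes.
  have h1 : thresholdExcess μ p (expPenalty μ p δ)
      = cyclePenalty μ p δ - expPenalty μ p δ * cycleLength μ δ := by
    rw [thresholdExcess, h.ageThreshold_expPenalty hδ, h.cycleExcess_eq _ hδ]
  have h2 : 0 ≤ cycleLength μ δ * expPenalty μ p δ - cyclePenalty μ p δ ↔
      thresholdExcess μ p (expPenalty μ p δ) ≤ 0 := by
    rw [h1]; constructor <;> intro <;> linarith
  rw [h2, ← hβ0]
  refine ⟨fun hle => ?_, fun hle => h.thresholdExcess_antitone ⟨δ, hδ, le_rfl⟩ hle⟩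
  by_contra hcon
  exact absurd (h.thresholdExcess_strictAnti hβ (not_le.1 hcon)) (not_lt.2 hle)

end PenaltyModel

/-! ### Independence of the past -/

/-- Adjoining independent information to a σ-algebra keeps it independent of another one. -/
theorem indep_sup_of_indep {Ω : Type*} {R A B mΩ : MeasurableSpace Ω} {P : Measure Ω}
    [IsProbabilityMeasure P] (hR : R ≤ mΩ) (hA : A ≤ mΩ) (hB : B ≤ mΩ)
    (hRAB : Indep R (A ⊔ B) P) (hAB : Indep A B P) : Indep (R ⊔ A) B P := by
  -- Intersections of one event from each σ-algebra form a π-system generating the join; on them the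
  -- probability factors by the two given independences.
  set π : Set (Set Ω) := {u | ∃ r a, MeasurableSet[R] r ∧ MeasurableSet[A] a ∧ u = r ∩ a}
  have hπ : IsPiSystem π := by
    rintro _ ⟨r, a, hr, ha, rfl⟩ _ ⟨r', a', hr', ha', rfl⟩ _
    exact ⟨r ∩ r', a ∩ a', MeasurableSet.inter hr hr', MeasurableSet.inter ha ha',
      Set.inter_inter_inter_comm _ _ _ _⟩
  have hgen : R ⊔ A = MeasurableSpace.generateFrom π := by
    refine le_antisymm (sup_le (fun r hr => ?_) fun a ha => ?_)
      (MeasurableSpace.generateFrom_le ?_)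
    · exact MeasurableSpace.measurableSet_generateFrom
        ⟨r, Set.univ, hr, MeasurableSet.univ, (Set.inter_univ r).symm⟩
    · exact MeasurableSpace.measurableSet_generateFrom
        ⟨Set.univ, a, MeasurableSet.univ, ha, (Set.univ_inter a).symm⟩
    · rintro _ ⟨r, a, hr, ha, rfl⟩
      exact MeasurableSet.inter ((le_sup_left : R ≤ R ⊔ A) _ hr) ((le_sup_right : A ≤ R ⊔ A) _ ha)
  refine IndepSets.indep (p1 := π) (p2 := {s | MeasurableSet[B] s}) (sup_le hR hA) hB hπ
    (@MeasurableSpace.isPiSystem_measurableSet _ B) hgen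
    (@MeasurableSpace.generateFrom_measurableSet _ B).symm ?_
  rw [IndepSets_iff]
  rintro _ b ⟨r, a, hr, ha, rfl⟩ hb
  rw [Indep_iff] at hRAB hAB
  have ha' : MeasurableSet[A ⊔ B] a := (le_sup_left : A ≤ A ⊔ B) _ ha
  have hb' : MeasurableSet[A ⊔ B] b := (le_sup_right : B ≤ A ⊔ B) _ hb
  rw [Set.inter_assoc, hRAB r (a ∩ b) hr (MeasurableSet.inter ha' hb'), hAB a b ha hb,
    hRAB r a hr ha', mul_assoc]

/-- Independent transmission times with the law `μ`, together with an independent source of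
randomization. -/
structure ServiceModel {Ω : Type*} (R : MeasurableSpace Ω) [mΩ : MeasurableSpace Ω]
    (P : Measure Ω) (Y : ℕ → Ω → ℝ) (μ : Measure ℝ) : Prop where
  meas : ∀ i, Measurable (Y i)
  nonneg : ∀ i ω, 0 ≤ Y i ω
  indep : iIndepFun Y P
  map_eq : ∀ i, P.map (Y i) = μ
  R_le : R ≤ mΩ
  R_indep : Indep R (⨆ i, MeasurableSpace.comap (Y i) inferInstance) P

section History

variable {Ω : Type*} {R : MeasurableSpace Ω} {Y : ℕ → Ω → ℝ}

theorem comap_le_history {i j : ℕ} (hij : i < j) :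
    MeasurableSpace.comap (Y i) inferInstance ≤ history R Y j := by
  refine le_trans ?_ le_sup_right
  exact le_iSup₂_of_le (f := fun l (_ : l < j) => MeasurableSpace.comap (Y l) inferInstance)
    i hij le_rfl

theorem history_mono {i j : ℕ} (hij : i ≤ j) : history R Y i ≤ history R Y j := by
  refine sup_le le_sup_left (iSup₂_le fun l hl => ?_)
  exact comap_le_history (hl.trans_le hij)

theorem measurable_history {i j : ℕ} (hij : i < j) : Measurable[history R Y j] (Y i) := by
  rw [measurable_iff_comap_le]
  exact comap_le_history hij

end History

namespace ServiceModel

variable {Ω : Type*} {R : MeasurableSpace Ω} [mΩ : MeasurableSpace Ω] {P : Measure Ω}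
  [IsProbabilityMeasure P] {Y : ℕ → Ω → ℝ} {μ : Measure ℝ}

theorem isProbabilityMeasure (M : ServiceModel R P Y μ) : IsProbabilityMeasure μ := by
  rw [← M.map_eq 0]
  exact Measure.isProbabilityMeasure_map (M.meas 0).aemeasurable

theorem history_le (M : ServiceModel R P Y μ) (i : ℕ) : history R Y i ≤ mΩ :=
  sup_le M.R_le (iSup₂_le fun j _ => (M.meas j).comap_le)

/-- Disjoint blocks of the `Y j` are independent, and the randomization is independent of both
blocks jointly, so it can be adjoined to the past. -/
theorem indep_future (M : ServiceModel R P Y μ) (i : ℕ) :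
    Indep (history R Y i) (⨆ j ∈ {j | i ≤ j}, MeasurableSpace.comap (Y j) inferInstance) P := by
  have hle : ∀ j, MeasurableSpace.comap (Y j) inferInstance ≤ mΩ := fun j => (M.meas j).comap_le
  refine indep_sup_of_indep M.R_le (iSup₂_le fun j _ => hle j) (iSup₂_le fun j _ => hle j) ?_ ?_
  · refine indep_of_indep_of_le_right M.R_indep (sup_le ?_ ?_) <;>
      exact iSup₂_le fun j _ => le_iSup (fun j => MeasurableSpace.comap (Y j) inferInstance) j
  · exact indep_iSup_of_disjoint (S := {j | j < i}) (T := {j | i ≤ j}) hle M.indep.iIndep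
      (Set.disjoint_left.2 fun j (h1 : j < i) (h2 : i ≤ j) => absurd h1 (not_lt.2 h2))

theorem comap_le_future {i j : ℕ} (hij : i ≤ j) : MeasurableSpace.comap (Y j) inferInstance
    ≤ ⨆ j ∈ {j | i ≤ j}, MeasurableSpace.comap (Y j) inferInstance :=
  le_iSup₂_of_le (f := fun l (_ : l ∈ {l | i ≤ l}) => MeasurableSpace.comap (Y l) inferInstance)
    j hij le_rfl

theorem indep_single (M : ServiceModel R P Y μ) (i : ℕ) :
    Indep (history R Y i) (MeasurableSpace.comap (Y i) inferInstance) P :=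
  indep_of_indep_of_le_right (M.indep_future i) (comap_le_future le_rfl)

theorem indep_pair (M : ServiceModel R P Y μ) (i : ℕ) :
    Indep (history R Y i)
      (MeasurableSpace.comap (fun ω => (Y i ω, Y (i + 1) ω)) inferInstance) P := by
  refine indep_of_indep_of_le_right (M.indep_future i) ?_
  refine Measurable.comap_le (Measurable.prodMk ?_ ?_)
  · exact (comap_measurable (Y i)).mono (comap_le_future le_rfl) le_rfl
  · exact (comap_measurable (Y (i + 1))).mono (comap_le_future (Nat.le_succ i)) le_rfl

theorem measurable_pair (M : ServiceModel R P Y μ) (i : ℕ) :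
    Measurable fun ω => (Y i ω, Y (i + 1) ω) := (M.meas i).prodMk (M.meas (i + 1))

theorem map_pair (M : ServiceModel R P Y μ) (i : ℕ) :
    P.map (fun ω => (Y i ω, Y (i + 1) ω)) = μ.prod μ := by
  have h := (indepFun_iff_map_prod_eq_prod_map_map (M.meas i).aemeasurable
    (M.meas (i + 1)).aemeasurable).1 (M.indep.indepFun (Nat.succ_ne_self i).symm)
  rw [h, M.map_eq, M.map_eq]

theorem integral_single (M : ServiceModel R P Y μ) (i : ℕ) {φ : ℝ → ℝ} (hφ : Measurable φ) :
    ∫ ω, φ (Y i ω) ∂P = ∫ y, φ y ∂μ := by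
  rw [← M.map_eq i, integral_map (M.meas i).aemeasurable hφ.aestronglyMeasurable]

theorem integrable_single (M : ServiceModel R P Y μ) (i : ℕ) {φ : ℝ → ℝ}
    (hφ : Integrable φ μ) : Integrable (fun ω => φ (Y i ω)) P := by
  rw [← M.map_eq i] at hφ
  exact hφ.comp_measurable (M.meas i)

theorem integral_pair (M : ServiceModel R P Y μ) (i : ℕ) {ψ : ℝ × ℝ → ℝ} (hψ : Measurable ψ) :
    ∫ ω, ψ (Y i ω, Y (i + 1) ω) ∂P = ∫ z, ψ z ∂(μ.prod μ) := by
  rw [← M.map_pair i, integral_map (M.measurable_pair i).aemeasurable hψ.aestronglyMeasurable]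

theorem integrable_pair (M : ServiceModel R P Y μ) (i : ℕ) {ψ : ℝ × ℝ → ℝ}
    (hψ : Integrable ψ (μ.prod μ)) : Integrable (fun ω => ψ (Y i ω, Y (i + 1) ω)) P := by
  rw [← M.map_pair i] at hψ
  exact hψ.comp_measurable (M.measurable_pair i)

theorem setIntegral_single (M : ServiceModel R P Y μ) (i : ℕ) {A : Set Ω}
    (hA : MeasurableSet[history R Y i] A) {φ : ℝ → ℝ} (hφ : Measurable φ) :
    ∫ ω in A, φ (Y i ω) ∂P = P.real A * ∫ y, φ y ∂μ := by
  rw [(M.indep_single i).setIntegral_eq_mul (M.history_le i) (M.meas i).aemeasurable hA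
    hφ.aestronglyMeasurable, M.integral_single i hφ]

theorem setIntegral_pair (M : ServiceModel R P Y μ) (i : ℕ) {A : Set Ω}
    (hA : MeasurableSet[history R Y i] A) {ψ : ℝ × ℝ → ℝ} (hψ : Measurable ψ) :
    ∫ ω in A, ψ (Y i ω, Y (i + 1) ω) ∂P = P.real A * ∫ z, ψ z ∂(μ.prod μ) := by
  rw [(M.indep_pair i).setIntegral_eq_mul (M.history_le i) (M.measurable_pair i).aemeasurable hA
    hψ.aestronglyMeasurable, M.integral_pair i hψ]

/-- If the conditional expectation given the history is nonnegative, so is the expectation. -/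
theorem integral_nonneg_of_history (M : ServiceModel R P Y μ) (i : ℕ) {E : Type*}
    [MeasurableSpace E] {X : Ω → E} (hX : Measurable[history R Y i] X) {g : E × ℝ → ℝ}
    (hg : Measurable g) (hint : Integrable (fun ω => g (X ω, Y i ω)) P)
    (hnn : ∀ ω, 0 ≤ ∫ w, g (X ω, w) ∂μ) : 0 ≤ ∫ ω, g (X ω, Y i ω) ∂P := by
  have := M.isProbabilityMeasure
  have hXm : Measurable X := hX.mono (M.history_le i) le_rfl
  have hind : IndepFun X (Y i) P :=
    indep_of_indep_of_le_left (M.indep_single i) hX.comap_le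
  have hmap : P.map (fun ω => (X ω, Y i ω)) = (P.map X).prod μ := by
    rw [(indepFun_iff_map_prod_eq_prod_map_map hXm.aemeasurable
      (M.meas i).aemeasurable).1 hind, M.map_eq]
  have hm : Measurable fun ω => (X ω, Y i ω) := hXm.prodMk (M.meas i)
  have : IsProbabilityMeasure (P.map X) := Measure.isProbabilityMeasure_map hXm.aemeasurable
  have hint' : Integrable g ((P.map X).prod μ) := by
    rw [← hmap]
    exact (integrable_map_measure hg.aestronglyMeasurable hm.aemeasurable).2 hint
  have heq : ∫ ω, g (X ω, Y i ω) ∂P = ∫ z, g z ∂((P.map X).prod μ) := by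
    rw [← hmap, integral_map hm.aemeasurable hg.aestronglyMeasurable]
  rw [heq, integral_prod _ hint', integral_map hXm.aemeasurable
    hint'.integral_prod_left.aestronglyMeasurable]
  exact integral_nonneg hnn

end ServiceModel

/-! ### Number of deliveries and the interval that contains the horizon -/

/-- Part of a function above the level `K`. -/
def tailPart {α : Type*} (e : α → ℝ) (K : ℝ) (z : α) : ℝ := {z | K < e z}.indicator e z

section TailPart

variable {α : Type*} {e : α → ℝ}

theorem tailPart_nonneg (he : ∀ z, 0 ≤ e z) (K : ℝ) (z : α) : 0 ≤ tailPart e K z :=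
  Set.indicator_nonneg (fun z _ => he z) z

theorem le_add_tailPart {K : ℝ} (hK : 0 ≤ K) (z : α) : e z ≤ K + tailPart e K z := by
  by_cases h : K < e z
  · rw [tailPart, Set.indicator_of_mem (show z ∈ {z | K < e z} from h)]; linarith
  · rw [tailPart, Set.indicator_of_notMem (show z ∉ {z | K < e z} from h)]; linarith

variable [MeasurableSpace α] {ν : Measure α}

theorem measurable_tailPart (he : Measurable e) (K : ℝ) : Measurable (tailPart e K) :=
  he.indicator (measurableSet_lt measurable_const he)

theorem integrable_tailPart (he : Measurable e) (hint : Integrable e ν) (K : ℝ) :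
    Integrable (tailPart e K) ν :=
  hint.indicator (measurableSet_lt measurable_const he)

theorem tendsto_integral_tailPart (he : Measurable e) (hint : Integrable e ν) :
    Tendsto (fun K => ∫ z, tailPart e K z ∂ν) atTop (nhds 0) := by
  have h : Tendsto (fun K => ∫ z, tailPart e K z ∂ν) atTop (nhds (∫ _, (0 : ℝ) ∂ν)) := by
    refine tendsto_integral_filter_of_dominated_convergence (fun z => ‖e z‖)
      (Eventually.of_forall fun K => (measurable_tailPart he K).aestronglyMeasurable)
      (Eventually.of_forall fun K => Eventually.of_forall fun z => norm_indicator_le_norm_self _ _)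
      hint.norm (Eventually.of_forall fun z => ?_)
    refine tendsto_const_nhds.congr' ?_
    filter_upwards [eventually_ge_atTop (e z)] with K hK
    exact (Set.indicator_of_notMem (show z ∉ {z | K < e z} from not_lt.2 hK) _).symm
  simpa using h

end TailPart

namespace Admissible

variable {Ω : Type*} {R : MeasurableSpace Ω} {Y : ℕ → Ω → ℝ} {π : Policy Ω}

theorem D_zero (A : Admissible R Y π) (ω : Ω) : π.D Y 0 ω = Y 0 ω := by
  simp [Policy.D, A.G_zero]

theorem D_add_le (A : Admissible R Y π) (i : ℕ) (ω : Ω) :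
    π.D Y i ω + Y (i + 1) ω ≤ π.D Y (i + 1) ω :=
  add_le_add_left (A.D_le_G i ω) _

theorem measurable_D (A : Admissible R Y π) (i : ℕ) : Measurable[history R Y (i + 1)] (π.D Y i) :=
  ((A.G_causal i).mono (history_mono i.le_succ) le_rfl).add (measurable_history i.lt_succ_self)

/-- The event that sample `i` is delivered before `T`. -/
def _root_.AoI.deliveredBefore (Y : ℕ → Ω → ℝ) (π : Policy Ω) (T : ℝ) (i : ℕ) : Set Ω :=
  {ω | π.D Y i ω < T}

/-- Whether sample `i` arrives before `T` involves `Y i` but no later service time. In a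
`ServiceModel` the event is thus independent of `Y (i + 1)` and its successors, but in general not
of `Y i`; this causes the index shifts below. -/
theorem measurableSet_deliveredBefore (A : Admissible R Y π) (T : ℝ) (i : ℕ) :
    MeasurableSet[history R Y (i + 1)] (deliveredBefore Y π T i) :=
  A.measurable_D i measurableSet_Iio

end Admissible

namespace ServiceModel

variable {Ω : Type*} {R : MeasurableSpace Ω} [mΩ : MeasurableSpace Ω] {P : Measure Ω}
  [IsProbabilityMeasure P] {Y : ℕ → Ω → ℝ} {μ : Measure ℝ} {π : Policy Ω}

theorem D_le_D_succ (M : ServiceModel R P Y μ) (A : Admissible R Y π) (i : ℕ) (ω : Ω) :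
    π.D Y i ω ≤ π.D Y (i + 1) ω := by
  linarith [A.D_add_le i ω, M.nonneg (i + 1) ω]

theorem D_mono (M : ServiceModel R P Y μ) (A : Admissible R Y π) (ω : Ω) :
    Monotone fun i => π.D Y i ω :=
  monotone_nat_of_le_succ fun i => M.D_le_D_succ A i ω

theorem D_nonneg (M : ServiceModel R P Y μ) (A : Admissible R Y π) (i : ℕ) (ω : Ω) :
    0 ≤ π.D Y i ω := by
  have := M.D_mono A ω (Nat.zero_le i)
  simp only [A.D_zero] at this
  exact (M.nonneg 0 ω).trans this

theorem deliveredBefore_succ_subset (M : ServiceModel R P Y μ) (A : Admissible R Y π) (T : ℝ)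
    (i : ℕ) : deliveredBefore Y π T (i + 1) ⊆ deliveredBefore Y π T i :=
  fun ω h => (M.D_le_D_succ A i ω).trans_lt h

theorem measurableSet_delivered (M : ServiceModel R P Y μ) (A : Admissible R Y π) (T : ℝ)
    (i : ℕ) : MeasurableSet (deliveredBefore Y π T i) :=
  M.history_le _ _ (A.measurableSet_deliveredBefore T i)

/-- The event that the horizon `T` falls between the deliveries of samples `i` and `i + 1`. -/
def _root_.AoI.crossing (Y : ℕ → Ω → ℝ) (π : Policy Ω) (T : ℝ) (i : ℕ) : Set Ω :=
  deliveredBefore Y π T i \ deliveredBefore Y π T (i + 1)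

theorem measurableSet_crossing (M : ServiceModel R P Y μ) (A : Admissible R Y π) (T : ℝ)
    (i : ℕ) : MeasurableSet (crossing Y π T i) :=
  (M.measurableSet_delivered A T i).diff (M.measurableSet_delivered A T (i + 1))

theorem setIntegral_crossing (M : ServiceModel R P Y μ) (A : Admissible R Y π) (T : ℝ)
    (i : ℕ) {f : Ω → ℝ} (hf : Integrable f P) : ∫ ω in crossing Y π T i, f ω ∂P
      = (∫ ω in deliveredBefore Y π T i, f ω ∂P) - ∫ ω in deliveredBefore Y π T (i + 1), f ω ∂P :=
  setIntegral_sdiff (M.measurableSet_delivered A T (i + 1)) hf.integrableOn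
    (M.deliveredBefore_succ_subset A T i)

theorem sum_measureReal_crossing_le (M : ServiceModel R P Y μ) (A : Admissible R Y π) (T : ℝ)
    (n : ℕ) : ∑ i ∈ Finset.range n, P.real (crossing Y π T i) ≤ 1 := by
  have h : ∀ i, P.real (crossing Y π T i)
      = P.real (deliveredBefore Y π T i) - P.real (deliveredBefore Y π T (i + 1)) := fun i =>
    measureReal_sdiff (M.deliveredBefore_succ_subset A T i) (M.measurableSet_delivered A T (i + 1))
  simp_rw [h]
  rw [Finset.sum_range_sub' (fun i => P.real (deliveredBefore Y π T i))]
  have h1 : P.real (deliveredBefore Y π T 0) ≤ 1 := measureReal_le_one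
  have h2 : 0 ≤ P.real (deliveredBefore Y π T n) := measureReal_nonneg
  linarith

/-- A bound for the expected number of deliveries before `T`. -/
theorem sum_measureReal_delivered_le (M : ServiceModel R P Y μ) (A : Admissible R Y π) {T : ℝ}
    (hT : 0 ≤ T) (n : ℕ) :
    (∑ i ∈ Finset.range n, P.real (deliveredBefore Y π T i)) * ∫ y, min y 1 ∂μ ≤ T + 1 := by
  have hφ : Measurable fun y : ℝ => min y 1 := by fun_prop
  have hφi : ∀ i, Integrable (fun ω => min (Y i ω) 1) P := fun i => by
    refine (integrable_const (1 : ℝ)).mono' (hφ.comp (M.meas i)).aestronglyMeasurable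
      (Eventually.of_forall fun ω => ?_)
    rw [Real.norm_of_nonneg (le_min (M.nonneg i ω) zero_le_one)]
    exact min_le_right _ _
  -- Wald's argument: `Y (i + 1)` is independent of the event that sample `i` is delivered before
  -- `T`.
  have hterm : ∀ i, P.real (deliveredBefore Y π T i) * ∫ y, min y 1 ∂μ
      = ∫ ω, (deliveredBefore Y π T i).indicator (fun ω => min (Y (i + 1) ω) 1) ω ∂P := fun i => by
    rw [integral_indicator (M.measurableSet_delivered A T i)]
    exact (M.setIntegral_single (i + 1) (A.measurableSet_deliveredBefore T i) hφ).symm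
  have hi : ∀ i, Integrable
      ((deliveredBefore Y π T i).indicator (fun ω => min (Y (i + 1) ω) 1)) P := fun i =>
    (hφi (i + 1)).indicator (M.measurableSet_delivered A T i)
  rw [Finset.sum_mul]
  simp_rw [hterm]
  rw [← integral_finsetSum _ fun i _ => hi i]
  have hpath : ∀ ω, ∑ i ∈ Finset.range n,
      (deliveredBefore Y π T i).indicator (fun ω => min (Y (i + 1) ω) 1) ω ≤ T + 1 := by
    intro ω
    -- Capping service times at `1` keeps each counted step inside `[0, T + 1]`, so the increments
    -- of the delivery times capped at `T + 1` dominate and telescope.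
    have hstep : ∀ i, (deliveredBefore Y π T i).indicator (fun ω => min (Y (i + 1) ω) 1) ω
        ≤ min (π.D Y (i + 1) ω) (T + 1) - min (π.D Y i ω) (T + 1) := by
      intro i
      by_cases h : π.D Y i ω < T
      · rw [Set.indicator_of_mem (show ω ∈ deliveredBefore Y π T i from h),
          min_eq_left (by linarith : π.D Y i ω ≤ T + 1), le_sub_iff_add_le]
        refine le_min ?_ ?_
        · linarith [min_le_left (Y (i + 1) ω) 1, A.D_add_le i ω]
        · linarith [min_le_right (Y (i + 1) ω) 1]
      · rw [Set.indicator_of_notMem (show ω ∉ deliveredBefore Y π T i from h), sub_nonneg]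
        exact min_le_min_right _ (M.D_le_D_succ A i ω)
    refine (Finset.sum_le_sum fun i _ => hstep i).trans ?_
    rw [Finset.sum_range_sub (fun i => min (π.D Y i ω) (T + 1))]
    have h1 : 0 ≤ min (π.D Y 0 ω) (T + 1) := le_min (M.D_nonneg A 0 ω) (by linarith)
    linarith [min_le_right (π.D Y n ω) (T + 1)]
  calc _ ≤ ∫ _ : Ω, (T + 1) ∂P :=
        integral_mono (integrable_finsetSum _ fun i _ => hi i) (integrable_const _) hpath
    _ = T + 1 := by simp

/-- The contribution of the interval that contains the horizon `T`, bounded by a level `K` and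
by the mean above this level times the expected number of deliveries. -/
def _root_.AoI.horizonError (μ : Measure ℝ) (e : ℝ × ℝ → ℝ) (K T : ℝ) : ℝ :=
  K + (1 + (T + 1) / ∫ y, min y 1 ∂μ) * ∫ z, tailPart e K z ∂(μ.prod μ)

variable {e : ℝ × ℝ → ℝ}

/-- The part of `e` below `K` is charged to the crossing probability, whose sum over `i` is at most
one. The tail is charged to all deliveries before `T`, because there independence is available. -/
theorem setIntegral_crossing_le (M : ServiceModel R P Y μ)
    (he : Measurable e) (he0 : ∀ z, 0 ≤ e z) (hint : Integrable e (μ.prod μ)) {K : ℝ}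
    (hK : 0 ≤ K) (T : ℝ) (i j : ℕ) :
    ∫ ω in crossing Y π T i, e (Y j ω, Y (j + 1) ω) ∂P ≤ K * P.real (crossing Y π T i)
      + ∫ ω in deliveredBefore Y π T i, tailPart e K (Y j ω, Y (j + 1) ω) ∂P := by
  have ht := M.integrable_pair j (integrable_tailPart he hint K)
  have h1 : ∫ ω in crossing Y π T i, e (Y j ω, Y (j + 1) ω) ∂P
      ≤ ∫ ω in crossing Y π T i, (K + tailPart e K (Y j ω, Y (j + 1) ω)) ∂P :=
    integral_mono (M.integrable_pair j hint).integrableOn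
      ((integrable_const K).add ht).integrableOn fun ω => le_add_tailPart hK _
  rw [integral_add (integrable_const K) ht.integrableOn, setIntegral_const, smul_eq_mul,
    mul_comm] at h1
  refine h1.trans (add_le_add le_rfl ?_)
  exact setIntegral_mono_set ht.integrableOn
    (Eventually.of_forall fun ω => tailPart_nonneg he0 K _)
    (Eventually.of_forall fun ω h => h.1)

/-- Common to the two index conventions `s i = i + 1` and `s i = i`. The extra `1` in `hs` makes
room for the first cycle in the unshifted case. -/
theorem sum_crossing_le_of_tail (M : ServiceModel R P Y μ) (A : Admissible R Y π)
    (he : Measurable e) (he0 : ∀ z, 0 ≤ e z) (hint : Integrable e (μ.prod μ))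
    (hc : 0 < ∫ y, min y 1 ∂μ) {K T : ℝ} (hK : 0 ≤ K) (hT : 0 ≤ T) (n : ℕ) (s : ℕ → ℕ)
    (hs : ∑ i ∈ Finset.range n,
        ∫ ω in deliveredBefore Y π T i, tailPart e K (Y (s i) ω, Y (s i + 1) ω) ∂P
      ≤ (1 + ∑ i ∈ Finset.range n, P.real (deliveredBefore Y π T i))
        * ∫ z, tailPart e K z ∂(μ.prod μ)) :
    ∑ i ∈ Finset.range n, ∫ ω in crossing Y π T i, e (Y (s i) ω, Y (s i + 1) ω) ∂P
      ≤ horizonError μ e K T := by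
  refine (Finset.sum_le_sum fun i _ =>
    M.setIntegral_crossing_le he he0 hint hK T i (s i)).trans ?_
  rw [Finset.sum_add_distrib, ← Finset.mul_sum]
  refine add_le_add ?_ (hs.trans ?_)
  · exact mul_le_of_le_one_right hK (M.sum_measureReal_crossing_le A T n)
  · refine mul_le_mul_of_nonneg_right ?_ (integral_nonneg fun z => tailPart_nonneg he0 K z)
    gcongr
    rw [le_div_iff₀ hc]
    exact M.sum_measureReal_delivered_le A hT n

theorem sum_crossing_succ_le (M : ServiceModel R P Y μ) (A : Admissible R Y π)
    (he : Measurable e) (he0 : ∀ z, 0 ≤ e z) (hint : Integrable e (μ.prod μ))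
    (hc : 0 < ∫ y, min y 1 ∂μ) {K T : ℝ} (hK : 0 ≤ K) (hT : 0 ≤ T) (n : ℕ) :
    ∑ i ∈ Finset.range n, ∫ ω in crossing Y π T i, e (Y (i + 1) ω, Y (i + 1 + 1) ω) ∂P
      ≤ horizonError μ e K T := by
  refine M.sum_crossing_le_of_tail A he he0 hint hc hK hT n (fun i => i + 1) ?_
  have h0 : 0 ≤ ∫ z, tailPart e K z ∂(μ.prod μ) := integral_nonneg fun z => tailPart_nonneg he0 K z
  simp_rw [M.setIntegral_pair _ (A.measurableSet_deliveredBefore T _) (measurable_tailPart he K)]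
  rw [← Finset.sum_mul]
  exact mul_le_mul_of_nonneg_right (by linarith) h0

/-- The pair `(Y i, Y (i + 1))` need not be independent of the delivery of sample `i` before `T`.
For the tail this event is enlarged to the delivery of sample `i - 1`, which is independent of the
pair; the term `i = 0` is bounded by the full mean. -/
theorem sum_crossing_le (M : ServiceModel R P Y μ) (A : Admissible R Y π)
    (he : Measurable e) (he0 : ∀ z, 0 ≤ e z) (hint : Integrable e (μ.prod μ))
    (hc : 0 < ∫ y, min y 1 ∂μ) {K T : ℝ} (hK : 0 ≤ K) (hT : 0 ≤ T) (n : ℕ) :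
    ∑ i ∈ Finset.range n, ∫ ω in crossing Y π T i, e (Y i ω, Y (i + 1) ω) ∂P
      ≤ horizonError μ e K T := by
  refine M.sum_crossing_le_of_tail A he he0 hint hc hK hT n (fun i => i) ?_
  have h0 : 0 ≤ ∫ z, tailPart e K z ∂(μ.prod μ) := integral_nonneg fun z => tailPart_nonneg he0 K z
  have hnn : ∀ (j : ℕ) ω, 0 ≤ tailPart e K (Y j ω, Y (j + 1) ω) := fun j ω => tailPart_nonneg he0 K _
  have ht := fun j => M.integrable_pair j (integrable_tailPart he hint K)
  rcases n with _ | n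
  · simpa using h0
  rw [Finset.sum_range_succ', add_mul, one_mul, add_comm]
  refine add_le_add ?_ ?_
  · rw [← M.integral_pair 0 (measurable_tailPart he K)]
    exact setIntegral_le_integral (ht 0) (Eventually.of_forall (hnn 0))
  · rw [Finset.sum_range_succ, add_mul, Finset.sum_mul]
    refine le_add_of_le_of_nonneg (Finset.sum_le_sum fun i _ => ?_)
      (mul_nonneg measureReal_nonneg h0)
    rw [← M.setIntegral_pair (i + 1) (A.measurableSet_deliveredBefore T i)
      (measurable_tailPart he K)]
    exact setIntegral_mono_set (ht _).integrableOn (Eventually.of_forall (hnn _))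
      (Eventually.of_forall (M.deliveredBefore_succ_subset A T i))

/-- A centered function of successive transmission times sums up, until the horizon, to an error
from the interval that contains the horizon. -/
theorem abs_sum_setIntegral_le (M : ServiceModel R P Y μ) (A : Admissible R Y π)
    (he : Measurable e) (he0 : ∀ z, 0 ≤ e z) (hint : Integrable e (μ.prod μ))
    (hc : 0 < ∫ y, min y 1 ∂μ) {c : ℝ × ℝ → ℝ} (hcm : Measurable c)
    (hc0 : ∫ z, c z ∂(μ.prod μ) = 0) (hce : ∀ᵐ z ∂(μ.prod μ), |c z| ≤ e z)
    {K T : ℝ} (hK : 0 ≤ K) (hT : 0 ≤ T) (n : ℕ) :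
    |∑ i ∈ Finset.range n, ∫ ω in deliveredBefore Y π T i, c (Y i ω, Y (i + 1) ω) ∂P|
      ≤ (∫ z, e z ∂(μ.prod μ)) + horizonError μ e K T := by
  have hci : Integrable c (μ.prod μ) := hint.mono' hcm.aestronglyMeasurable hce
  have heP := fun j => M.integrable_pair j hint
  have hcP := fun j => M.integrable_pair j hci
  have hceP : ∀ j, ∀ᵐ ω ∂P, |c (Y j ω, Y (j + 1) ω)| ≤ e (Y j ω, Y (j + 1) ω) := by
    intro j
    rw [← M.map_pair j] at hce
    exact ae_of_ae_map (M.measurable_pair j).aemeasurable hce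
  have hset : ∀ (j : ℕ) (B : Set Ω), |∫ ω in B, c (Y j ω, Y (j + 1) ω) ∂P|
      ≤ ∫ ω in B, e (Y j ω, Y (j + 1) ω) ∂P := fun j B =>
    abs_integral_le_integral_abs.trans (integral_mono_ae (hcP j).abs.integrableOn
      (heP j).integrableOn (ae_restrict_of_ae (hceP j)))
  have hI : 0 ≤ ∫ z, e z ∂(μ.prod μ) := integral_nonneg he0
  have hH := M.sum_crossing_succ_le A he he0 hint hc hK hT
  rcases n with _ | n
  · have := hH 0
    simp only [Finset.range_zero, Finset.sum_empty, abs_zero] at this ⊢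
    linarith
  rw [Finset.sum_range_succ', add_comm]
  refine (abs_add_le _ _).trans (add_le_add ?_ ?_)
  · refine (hset 0 _).trans ?_
    rw [← M.integral_pair 0 he]
    exact setIntegral_le_integral (heP 0) (Eventually.of_forall fun _ => he0 _)
  · refine (Finset.abs_sum_le_sum_abs _ _).trans
      ((Finset.sum_le_sum fun i _ => ?_).trans (hH n))
    -- Over the delivery of sample `i` the centered function of the next pair integrates to zero.
    -- Its integral over the delivery of sample `i + 1` is therefore minus the integral over the
    -- crossing event.
    have h1 := M.setIntegral_crossing A T i (hcP (i + 1))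
    rw [M.setIntegral_pair (i + 1) (A.measurableSet_deliveredBefore T i) hcm, hc0, mul_zero,
      zero_sub] at h1
    rw [← abs_neg, ← h1]
    exact hset (i + 1) _

/-- The expected number of deliveries before `T` is finite, so these probabilities are summable.
This disposes of the time after the `n`-th delivery as `n → ∞`. -/
theorem tendsto_measureReal_delivered (M : ServiceModel R P Y μ) (A : Admissible R Y π)
    (hc : 0 < ∫ y, min y 1 ∂μ) {T : ℝ} (hT : 0 ≤ T) :
    Tendsto (fun n => P.real (deliveredBefore Y π T n)) atTop (nhds 0) := by
  refine (summable_of_sum_range_le (c := (T + 1) / ∫ y, min y 1 ∂μ)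
    (fun n => measureReal_nonneg) fun n => ?_).tendsto_atTop_zero
  rw [le_div_iff₀ hc]
  exact M.sum_measureReal_delivered_le A hT n

end ServiceModel

/-! ### The age along a trajectory -/

namespace ServiceModel

variable {Ω : Type*} {R : MeasurableSpace Ω} [mΩ : MeasurableSpace Ω] {P : Measure Ω}
  [IsProbabilityMeasure P] {Y : ℕ → Ω → ℝ} {μ : Measure ℝ} {π : Policy Ω} {a₀ : ℝ}

theorem S_mono (A : Admissible R Y π) (ω : Ω) : Monotone fun i => π.S i ω :=
  monotone_nat_of_le_succ fun i => A.S_le_succ i ω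

theorem S_nonneg (A : Admissible R Y π) (i : ℕ) (ω : Ω) : 0 ≤ π.S i ω := by
  have := S_mono A ω (Nat.zero_le i)
  simpa only [A.S_zero] using this

theorem S_add_le_D (A : Admissible R Y π) (i : ℕ) (ω : Ω) :
    π.S i ω + Y i ω ≤ π.D Y i ω := add_le_add_left (A.S_le_G i ω) _

theorem S_le_D (M : ServiceModel R P Y μ) (A : Admissible R Y π) (i : ℕ) (ω : Ω) :
    π.S i ω ≤ π.D Y i ω := by
  linarith [S_add_le_D A i ω, M.nonneg i ω]

/-- Generation time of the freshest delivered sample as a supremum over all samples. -/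
theorem sSup_delivered_eq (A : Admissible R Y π) {ω : Ω} {t : ℝ} (ht : π.D Y 0 ω ≤ t) :
    sSup {s : ℝ | ∃ i, π.D Y i ω ≤ t ∧ s = π.S i ω}
      = ⨆ i, if π.D Y i ω ≤ t then π.S i ω else 0 := by
  rw [iSup]
  congr 1
  ext s
  constructor
  · rintro ⟨i, hi, rfl⟩
    exact ⟨i, if_pos hi⟩
  · rintro ⟨i, rfl⟩
    by_cases hi : π.D Y i ω ≤ t
    · exact ⟨i, hi, if_pos hi⟩
    -- The default value `0` equals `S 0`, and sample `0` is already delivered, so it adds nothing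
    -- to the set.
    · exact ⟨0, ht, by simp only [if_neg hi, A.S_zero]⟩

theorem measurable_age (M : ServiceModel R P Y μ) (A : Admissible R Y π) :
    Measurable fun z : Ω × ℝ => age a₀ Y π z.1 z.2 := by
  have hS : ∀ i, Measurable (π.S i) := fun i => (A.S_meas i).mono (M.history_le i) le_rfl
  have hD : ∀ i, Measurable (π.D Y i) := fun i =>
    (A.measurable_D i).mono (M.history_le (i + 1)) le_rfl
  have heq : (fun z : Ω × ℝ => age a₀ Y π z.1 z.2) = fun z : Ω × ℝ =>
      if z.2 < π.D Y 0 z.1 then a₀ + z.2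
      else z.2 - ⨆ i, if π.D Y i z.1 ≤ z.2 then π.S i z.1 else 0 := by
    ext z
    unfold age
    split_ifs with h
    · rfl
    · rw [sSup_delivered_eq A (not_lt.1 h)]
  rw [heq]
  refine Measurable.ite (measurableSet_lt measurable_snd ((hD 0).comp measurable_fst))
    (measurable_snd.const_add a₀) (measurable_snd.sub (Measurable.iSup fun i => ?_))
  exact Measurable.ite (measurableSet_le ((hD i).comp measurable_fst) measurable_snd)
    ((hS i).comp measurable_fst) measurable_const

theorem age_nonneg (M : ServiceModel R P Y μ) (A : Admissible R Y π) (ha₀ : 0 ≤ a₀) {ω : Ω}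
    {t : ℝ} (ht : 0 ≤ t) : 0 ≤ age a₀ Y π ω t := by
  unfold age
  split_ifs with h
  · exact add_nonneg ha₀ ht
  · rw [sub_nonneg]
    refine csSup_le ⟨_, 0, not_lt.1 h, rfl⟩ ?_
    rintro _ ⟨i, hi, rfl⟩
    exact (M.S_le_D A i ω).trans hi

theorem age_le (A : Admissible R Y π) (ha₀ : 0 ≤ a₀) (ω : Ω)
    (t : ℝ) : age a₀ Y π ω t ≤ a₀ + t := by
  unfold age
  split_ifs with h
  · exact le_rfl
  · have : 0 ≤ sSup {s : ℝ | ∃ i, π.D Y i ω ≤ t ∧ s = π.S i ω} := by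
      refine Real.sSup_nonneg ?_
      rintro _ ⟨i, -, rfl⟩
      exact S_nonneg A i ω
    linarith

theorem age_of_lt (ω : Ω) {t : ℝ} (ht : t < π.D Y 0 ω) : age a₀ Y π ω t = a₀ + t := if_pos ht

theorem age_of_mem_Ico (M : ServiceModel R P Y μ) (A : Admissible R Y π) {ω : Ω} {i : ℕ} {t : ℝ}
    (h1 : π.D Y i ω ≤ t) (h2 : t < π.D Y (i + 1) ω) : age a₀ Y π ω t = t - π.S i ω := by
  have h0 : π.D Y 0 ω ≤ t := (M.D_mono A ω (Nat.zero_le i)).trans h1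
  have hmax : IsGreatest {s : ℝ | ∃ i, π.D Y i ω ≤ t ∧ s = π.S i ω} (π.S i ω) := by
    refine ⟨⟨i, h1, rfl⟩, ?_⟩
    rintro _ ⟨j, hj, rfl⟩
    refine S_mono A ω ?_
    by_contra hij
    exact absurd (M.D_mono A ω (Nat.succ_le_of_lt (not_le.1 hij))) (not_le.2 (hj.trans_lt h2))
  rw [age, if_neg (not_lt.2 h0), hmax.csSup_eq]

variable {p : ℝ → ℝ} {β : ℝ}

/-- A bound for the excess penalty on the horizon `[0, T]`. -/
def _root_.AoI.excessBound (p : ℝ → ℝ) (β a₀ T : ℝ) : ℝ := |p 0 - β| + |p (a₀ + T) - β|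

theorem abs_excess_age_le (M : ServiceModel R P Y μ) (A : Admissible R Y π) (hp : Monotone p)
    (ha₀ : 0 ≤ a₀) {ω : Ω} {t T : ℝ} (ht : 0 ≤ t) (htT : t ≤ T) :
    |p (age a₀ Y π ω t) - β| ≤ excessBound p β a₀ T := by
  have h1 := hp (M.age_nonneg A ha₀ (ω := ω) ht)
  have h2 := hp ((age_le A ha₀ ω t).trans (add_le_add_right htT a₀))
  have h3 := neg_abs_le (p 0 - β)
  have h4 := le_abs_self (p (a₀ + T) - β)
  have h5 := abs_nonneg (p 0 - β)
  have h6 := abs_nonneg (p (a₀ + T) - β)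
  rw [excessBound, abs_le]
  constructor <;> linarith

theorem measurable_excess_age (M : ServiceModel R P Y μ) (A : Admissible R Y π)
    (hp : Monotone p) : Measurable fun z : Ω × ℝ => p (age a₀ Y π z.1 z.2) - β :=
  (hp.measurable.comp (M.measurable_age A)).sub_const β

theorem intervalIntegrable_excess_age (M : ServiceModel R P Y μ) (A : Admissible R Y π)
    (hp : Monotone p) (ha₀ : 0 ≤ a₀) (ω : Ω) {u v : ℝ} (hu : 0 ≤ u) (hv : 0 ≤ v) :
    IntervalIntegrable (fun t => p (age a₀ Y π ω t) - β) volume u v := by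
  refine (intervalIntegrable_const (c := excessBound p β a₀ (max u v))).mono_fun' ?_ ?_
  · exact ((M.measurable_excess_age A hp).comp measurable_prodMk_left).aestronglyMeasurable
  · filter_upwards [ae_restrict_mem measurableSet_uIoc] with t ht
    exact M.abs_excess_age_le A hp ha₀ ((le_min hu hv).trans ht.1.le) ht.2

theorem integrable_integral_excess_age (M : ServiceModel R P Y μ) (A : Admissible R Y π)
    (hp : Monotone p) (ha₀ : 0 ≤ a₀) {T : ℝ} (hT : 0 ≤ T) :
    Integrable (fun ω => ∫ t in (0 : ℝ)..T, (p (age a₀ Y π ω t) - β)) P := by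
  refine (integrable_const (excessBound p β a₀ T * |T - 0|)).mono' ?_
    (Eventually.of_forall fun ω => ?_)
  · simp_rw [intervalIntegral.integral_of_le hT]
    exact (M.measurable_excess_age A hp).stronglyMeasurable.integral_prod_right'.aestronglyMeasurable
  · refine intervalIntegral.norm_integral_le_of_norm_le_const fun t ht => ?_
    rw [Set.uIoc_of_le hT] at ht
    exact M.abs_excess_age_le A hp ha₀ ht.1.le ht.2

/-- The excess accumulated between the deliveries of samples `i` and `i + 1`, up to `T`, if
sample `i` was generated at time `s`. -/
def _root_.AoI.stageExcess (p : ℝ → ℝ) (β : ℝ) (Y : ℕ → Ω → ℝ) (π : Policy Ω) (T s : ℝ) (i : ℕ)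
    (ω : Ω) : ℝ :=
  ∫ t in (min (π.D Y i ω) T)..(min (π.D Y (i + 1) ω) T), (p (t - s) - β)

theorem integral_age_eq_stageExcess (M : ServiceModel R P Y μ) (A : Admissible R Y π)
    (T : ℝ) (i : ℕ) (ω : Ω) :
    ∫ t in (min (π.D Y i ω) T)..(min (π.D Y (i + 1) ω) T), (p (age a₀ Y π ω t) - β)
      = stageExcess p β Y π T (π.S i ω) i ω := by
  have hle := min_le_min_right T (M.D_le_D_succ A i ω)
  rw [stageExcess, intervalIntegral.integral_of_le hle, intervalIntegral.integral_of_le hle,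
    integral_Ioc_eq_integral_Ioo, integral_Ioc_eq_integral_Ioo]
  refine setIntegral_congr_fun measurableSet_Ioo fun t ht => ?_
  have h2 : t < π.D Y (i + 1) ω := ht.2.trans_le (min_le_left _ _)
  have h1 : π.D Y i ω ≤ t := by
    rcases min_lt_iff.1 ht.1 with h | h
    · exact h.le
    · exact absurd (ht.2.trans_le (min_le_right _ _)) (not_lt.2 h.le)
  rw [M.age_of_mem_Ico A h1 h2]

/-- Up to the first delivery and the time after the `n`-th one, the excess penalty is the sum over
the inter-delivery intervals. -/
theorem abs_integral_age_sub_sum_le (M : ServiceModel R P Y μ) (A : Admissible R Y π)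
    (hp : Monotone p) (ha₀ : 0 ≤ a₀) {K : ℝ} (hK : a₀ ≤ K) {T : ℝ} (hT : 0 ≤ T) (n : ℕ) (ω : Ω) :
    |(∫ t in (0 : ℝ)..T, (p (age a₀ Y π ω t) - β))
        - ∑ i ∈ Finset.range n, stageExcess p β Y π T (π.S i ω) i ω|
      ≤ (∫ s in (0 : ℝ)..(K + Y 0 ω), |p s - β|)
        + (deliveredBefore Y π T n).indicator (fun _ => excessBound p β a₀ T * T) ω := by
  have hint : ∀ {u v : ℝ}, 0 ≤ u → 0 ≤ v →
      IntervalIntegrable (fun t => p (age a₀ Y π ω t) - β) volume u v :=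
    fun hu hv => M.intervalIntegrable_excess_age A hp ha₀ ω hu hv
  have hm : ∀ i, 0 ≤ min (π.D Y i ω) T := fun i => le_min (M.D_nonneg A i ω) hT
  have hsum : ∑ i ∈ Finset.range n, stageExcess p β Y π T (π.S i ω) i ω
      = ∫ t in (min (π.D Y 0 ω) T)..(min (π.D Y n ω) T), (p (age a₀ Y π ω t) - β) := by
    rw [← intervalIntegral.sum_integral_adjacent_intervals
      (a := fun i => min (π.D Y i ω) T) fun i _ => hint (hm i) (hm (i + 1))]
    exact Finset.sum_congr rfl fun i _ => (M.integral_age_eq_stageExcess A T i ω).symm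
  have hsplit : (∫ t in (0 : ℝ)..T, (p (age a₀ Y π ω t) - β))
      - ∑ i ∈ Finset.range n, stageExcess p β Y π T (π.S i ω) i ω
      = (∫ t in (0 : ℝ)..(min (π.D Y 0 ω) T), (p (age a₀ Y π ω t) - β))
        + ∫ t in (min (π.D Y n ω) T)..T, (p (age a₀ Y π ω t) - β) := by
    rw [hsum, ← intervalIntegral.integral_add_adjacent_intervals (hint le_rfl (hm 0))
      (hint (hm 0) hT), ← intervalIntegral.integral_add_adjacent_intervals
      (hint (hm 0) (hm n)) (hint (hm n) hT)]
    ring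
  rw [hsplit]
  refine (abs_add_le _ _).trans (add_le_add ?_ ?_)
  -- Before the first delivery the age is `a₀ + t` with `t < Y 0 ω`, so all ages lie in `[0, K + Y 0
  -- ω]`.
  · have h1 : ∫ t in (0 : ℝ)..(min (π.D Y 0 ω) T), (p (age a₀ Y π ω t) - β)
        = ∫ s in (a₀ + 0)..(a₀ + min (π.D Y 0 ω) T), (p s - β) := by
      rw [← intervalIntegral.integral_comp_add_left (fun s => p s - β),
        intervalIntegral.integral_of_le (hm 0), intervalIntegral.integral_of_le (hm 0),
        integral_Ioc_eq_integral_Ioo, integral_Ioc_eq_integral_Ioo]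
      refine setIntegral_congr_fun measurableSet_Ioo fun t ht => ?_
      rw [age_of_lt ω (ht.2.trans_le (min_le_left _ _))]
    have h2 : min (π.D Y 0 ω) T ≤ Y 0 ω := (min_le_left _ _).trans_eq (A.D_zero ω)
    have h3 := M.nonneg 0 ω
    have h4 := hm 0
    rw [h1]
    exact abs_integral_le_of_monotone (hp.sub_const_real β) (by linarith) (by linarith)
      (by linarith) (by linarith)
  -- After the `n`-th delivery a crude bound suffices, since its weight, the probability of that
  -- delivery before `T`, tends to zero.
  · by_cases h : π.D Y n ω < T
    · rw [Set.indicator_of_mem (show ω ∈ deliveredBefore Y π T n from h), min_eq_left h.le]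
      have hD := M.D_nonneg A n ω
      have hb := intervalIntegral.norm_integral_le_of_norm_le_const (a := π.D Y n ω) (b := T)
        (f := fun t => p (age a₀ Y π ω t) - β) (C := excessBound p β a₀ T) fun t ht => by
          rw [Set.uIoc_of_le h.le] at ht
          exact M.abs_excess_age_le A hp ha₀ (hD.trans ht.1.le) ht.2
      refine hb.trans (mul_le_mul_of_nonneg_left ?_ ?_)
      · rw [abs_of_pos (sub_pos.2 h)]; linarith
      · exact add_nonneg (abs_nonneg _) (abs_nonneg _)
    · rw [Set.indicator_of_notMem (show ω ∉ deliveredBefore Y π T n from h),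
        min_eq_right (not_lt.1 h)]
      simp

/-- A later generation of the sample decreases the penalty. -/
theorem stageExcess_le (M : ServiceModel R P Y μ) (A : Admissible R Y π) (hp : Monotone p)
    {s s' : ℝ} (hs : s ≤ s') (T : ℝ) (i : ℕ) (ω : Ω) :
    stageExcess p β Y π T s' i ω ≤ stageExcess p β Y π T s i ω := by
  have hm : ∀ s : ℝ, Monotone fun t => p (t - s) - β := fun s _ _ h =>
    sub_le_sub_right (hp (sub_le_sub_right h s)) β
  refine intervalIntegral.integral_mono_on (min_le_min_right T (M.D_le_D_succ A i ω))
    (hm s').intervalIntegrable (hm s).intervalIntegrable fun t _ => ?_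
  exact sub_le_sub_right (hp (by linarith)) β

/-- Time is measured from `G i`, so that sample `i` arrives at age `Y i` and the horizon appears as
the age cutoff `T - G i`. -/
theorem stageExcess_eq_of_lt {T : ℝ} {i : ℕ} {ω : Ω}
    (h : π.D Y i ω < T) : stageExcess p β Y π T (π.G i ω) i ω
      = ∫ s in (Y i ω)..(min ((π.G (i + 1) ω - π.G i ω) + Y (i + 1) ω) (T - π.G i ω)),
          (p s - β) := by
  rw [stageExcess, min_eq_left h.le,
    intervalIntegral.integral_comp_sub_right (fun s => p s - β)]
  congr 1
  · simp [Policy.D]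
  · rw [← min_sub_sub_right]
    congr 1
    simp only [Policy.D]; ring

theorem stageExcess_eq_zero (M : ServiceModel R P Y μ) (A : Admissible R Y π) {T : ℝ} {i : ℕ}
    {ω : Ω} (h : ¬ π.D Y i ω < T) (s : ℝ) : stageExcess p β Y π T s i ω = 0 := by
  rw [stageExcess, min_eq_right (not_lt.1 h),
    min_eq_right ((not_lt.1 h).trans (M.D_le_D_succ A i ω)), intervalIntegral.integral_same]

end ServiceModel

/-! ### Bounds for the accumulated excess penalty -/

/-- A bound for the excess penalty of an inter-delivery interval in which one does not wait beyond
the age `K`. -/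
def cycleBound (p : ℝ → ℝ) (β K : ℝ) (z : ℝ × ℝ) : ℝ :=
  |(∫ s in (0 : ℝ)..(max z.1 K + z.2), |p s - β|)|

section Deterministic

variable {p : ℝ → ℝ} {β K : ℝ}

theorem measurable_cycleBound (hp : Monotone p) : Measurable (cycleBound p β K) :=
  (((continuous_integral_abs_of_monotone (hp.sub_const_real β)).comp
    (by fun_prop : Continuous fun z : ℝ × ℝ => max z.1 K + z.2)).abs).measurable

/-- The outer absolute value makes this hold even at pairs with negative entries, as the tail
estimates require nonnegativity at every point. -/
theorem cycleBound_nonneg (z : ℝ × ℝ) : 0 ≤ cycleBound p β K z := abs_nonneg _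

theorem abs_integral_le_cycleBound (hp : Monotone p) {y w a b : ℝ} (ha : 0 ≤ a) (hb : 0 ≤ b)
    (ha' : a ≤ max y K + w) (hb' : b ≤ max y K + w) :
    |∫ s in a..b, (p s - β)| ≤ cycleBound p β K (y, w) :=
  (abs_integral_le_of_monotone (hp.sub_const_real β) ha hb ha' hb').trans (le_abs_self _)

/-- Truncating an interval at the age `τ` changes the excess by at most `cycleBound`. -/
theorem abs_integral_min_sub_le (hp : Monotone p) {x y w τ : ℝ} (hy : 0 ≤ y) (hyx : y ≤ x)
    (hw : 0 ≤ w) (hxK : x ≤ max y K) (hyτ : y ≤ τ) :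
    |(∫ s in y..(min (x + w) τ), (p s - β)) - ∫ s in y..(x + w), (p s - β)|
      ≤ cycleBound p β K (y, w) := by
  have hq := hp.sub_const_real β
  rw [intervalIntegral.integral_interval_sub_left hq.intervalIntegrable hq.intervalIntegrable]
  refine abs_integral_le_cycleBound hp (by linarith) (le_min (by linarith) (by linarith))
    (by linarith) ?_
  exact (min_le_left _ _).trans (by linarith)

/-- Waiting beyond an age at which the penalty rate is nonnegative does not decrease the excess. -/
theorem integral_clip_le (hp : Monotone p) (hK : ∀ s, K ≤ s → β ≤ p s) {x y w τ : ℝ}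
    (hw : 0 ≤ w) :
    ∫ s in y..(min (min x (max y K) + w) τ), (p s - β) ≤ ∫ s in y..(min (x + w) τ), (p s - β) := by
  have hq := hp.sub_const_real β
  rw [← sub_nonneg, intervalIntegral.integral_interval_sub_left hq.intervalIntegrable
    hq.intervalIntegrable]
  rcases le_total x (max y K) with hx | hx
  · rw [min_eq_left hx, intervalIntegral.integral_same]
  rw [min_eq_right hx]
  rcases le_total (max y K + w) τ with hτ | hτ
  · rw [min_eq_left hτ]
    refine intervalIntegral.integral_nonneg (le_min (by linarith) hτ) fun s hs => ?_
    exact sub_nonneg.2 (hK s (by linarith [hs.1, le_max_right y K]))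
  · rw [min_eq_right hτ, min_eq_right (by linarith), intervalIntegral.integral_same]

end Deterministic

theorem PenaltyModel.integrable_cycleBound {μ : Measure ℝ} [IsProbabilityMeasure μ] {p : ℝ → ℝ}
    (h : PenaltyModel μ p) (β : ℝ) {K : ℝ} (hK : 0 ≤ K) :
    Integrable (cycleBound p β K) (μ.prod μ) := (h.integrable_integral_abs β hK).abs

/-- Almost every section of the two-variable bound is integrable, and any one of them dominates
because `max x K ≥ K`. -/
theorem PenaltyModel.integrable_integral_abs_add {μ : Measure ℝ} [IsProbabilityMeasure μ]
    {p : ℝ → ℝ} (h : PenaltyModel μ p) (β : ℝ) {K : ℝ} (hK : 0 ≤ K) :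
    Integrable (fun y : ℝ => ∫ s in (0 : ℝ)..(K + y), |p s - β|) μ := by
  obtain ⟨x, hx⟩ := (h.integrable_integral_abs β hK).prod_right_ae.exists
  have hq := h.mono.sub_const_real β
  refine hx.mono' ((continuous_integral_abs_of_monotone hq).comp
    (by fun_prop : Continuous fun y : ℝ => K + y)).aestronglyMeasurable ?_
  filter_upwards [h.nonneg] with y hy
  rw [Real.norm_of_nonneg (intervalIntegral.integral_nonneg (by linarith)
    fun _ _ => abs_nonneg _)]
  exact monotoneOn_integral_abs hq (by linarith [le_max_right x K])

theorem PenaltyModel.integral_min_one_pos {μ : Measure ℝ} [IsProbabilityMeasure μ]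
    {p : ℝ → ℝ} (h : PenaltyModel μ p) : 0 < ∫ y, min y 1 ∂μ := by
  have hnn : 0 ≤ᵐ[μ] fun y => min y 1 := by
    filter_upwards [h.nonneg] with y hy using le_min hy zero_le_one
  have hint : Integrable (fun y : ℝ => min y 1) μ := h.int_id.inf (integrable_const 1)
  refine lt_of_le_of_ne (integral_nonneg_of_ae hnn) fun h0 => ?_
  have hz := (integral_eq_zero_iff_of_nonneg_ae hnn hint).1 h0.symm
  have : (fun y : ℝ => y) =ᵐ[μ] 0 := by
    filter_upwards [hz] with y hy
    simp only [Pi.zero_apply] at hy ⊢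
    rcases min_choice y 1 with h1 | h1 <;> linarith
  have hm := h.mean_pos
  rw [integral_congr_ae this] at hm
  simp at hm

namespace ServiceModel

variable {Ω : Type*} {R : MeasurableSpace Ω} [mΩ : MeasurableSpace Ω] {P : Measure Ω}
  [IsProbabilityMeasure P] {Y : ℕ → Ω → ℝ} {μ : Measure ℝ} [IsProbabilityMeasure μ]
  {π : Policy Ω} {a₀ : ℝ} {p : ℝ → ℝ} {β K : ℝ}

/-- Age at the start of the transmission of sample `i + 1` if sample `i` was generated at the start
of its own transmission, cut off at `max (Y i) K`. -/
def _root_.AoI.clippedAge (Y : ℕ → Ω → ℝ) (π : Policy Ω) (K : ℝ) (i : ℕ) (ω : Ω) : ℝ :=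
  min (π.G (i + 1) ω - π.G i ω) (max (Y i ω) K)

theorem le_G_sub (A : Admissible R Y π) (i : ℕ) (ω : Ω) :
    Y i ω ≤ π.G (i + 1) ω - π.G i ω := by
  have := A.D_le_G i ω
  rw [Policy.D] at this
  linarith

theorem le_clippedAge (A : Admissible R Y π) (K : ℝ) (i : ℕ) (ω : Ω) :
    Y i ω ≤ clippedAge Y π K i ω := le_min (le_G_sub A i ω) (le_max_left _ _)

theorem measurable_clippedAge (A : Admissible R Y π) (K : ℝ) (i : ℕ) :
    Measurable[history R Y (i + 1)] (clippedAge Y π K i) := by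
  have h1 := A.G_causal (i + 1)
  have h2 := (A.G_causal i).mono (history_mono i.le_succ) le_rfl
  have h3 : Measurable[history R Y (i + 1)] (Y i) := measurable_history i.lt_succ_self
  exact Measurable.min (h1.sub h2) (h3.max measurable_const)

theorem mem_crossing_of {T : ℝ} {i : ℕ} {ω : Ω}
    (h : π.D Y i ω < T) (h' : T ≤ π.D Y (i + 1) ω) : ω ∈ crossing Y π T i :=
  ⟨h, not_lt.2 h'⟩

/-- Three reductions lower the excess: sample `i` is taken as generated at `G i`, the next start is
clipped at `max (Y i) K` beyond which `p ≥ β`, and the cutoff at `T` is removed. Only the last has a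
cost, at most `cycleBound`, and only when `T` falls in this cycle. -/
theorem indicator_sub_le_stageExcess (M : ServiceModel R P Y μ) (A : Admissible R Y π)
    (hp : Monotone p) (hK : ∀ s, K ≤ s → β ≤ p s) (T : ℝ) (i : ℕ) (ω : Ω) :
    (deliveredBefore Y π T i).indicator
        (fun ω => ∫ s in (Y i ω)..(clippedAge Y π K i ω + Y (i + 1) ω), (p s - β)) ω
      - (crossing Y π T i).indicator (fun ω => cycleBound p β K (Y i ω, Y (i + 1) ω)) ω
      ≤ stageExcess p β Y π T (π.S i ω) i ω := by
  refine le_trans ?_ (M.stageExcess_le A hp (A.S_le_G i ω) T i ω)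
  by_cases h : π.D Y i ω < T
  · rw [Set.indicator_of_mem (show ω ∈ deliveredBefore Y π T i from h), stageExcess_eq_of_lt h]
    refine le_trans ?_ (integral_clip_le hp hK (M.nonneg (i + 1) ω))
    have hτ : Y i ω ≤ T - π.G i ω := by
      rw [Policy.D] at h; linarith
    by_cases h' : π.D Y (i + 1) ω < T
    · rw [Set.indicator_of_notMem (show ω ∉ crossing Y π T i from fun hc => hc.2 h'), sub_zero,
        min_eq_left (a := _ + _)]
      · exact le_rfl
      · have := min_le_left (π.G (i + 1) ω - π.G i ω) (max (Y i ω) K)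
        rw [Policy.D] at h'
        linarith
    · rw [Set.indicator_of_mem (mem_crossing_of h (not_lt.1 h'))]
      have := abs_integral_min_sub_le (β := β) hp (M.nonneg i ω) (le_clippedAge A K i ω)
        (M.nonneg (i + 1) ω) (min_le_right _ _) hτ
      have := neg_le_of_abs_le this
      change _ ≤ ∫ s in (Y i ω)..(min (clippedAge Y π K i ω + Y (i + 1) ω) (T - π.G i ω)), (p s - β)
      linarith
  · rw [Set.indicator_of_notMem (show ω ∉ deliveredBefore Y π T i from h),
      M.stageExcess_eq_zero A h]
    have := Set.indicator_nonneg (s := crossing Y π T i)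
      (fun ω _ => cycleBound_nonneg (p := p) (β := β) (K := K) (Y i ω, Y (i + 1) ω)) ω
    linarith

/-- The threshold rule never waits beyond `max (Y i) K`, so no clipping is needed; only removing the
cutoff at `T` has a cost. -/
theorem stageExcess_le_indicator_add (M : ServiceModel R P Y μ) (A : Admissible R Y π)
    (hp : Monotone p) {d : ℝ} (hdK : d ≤ K)
    (hG : ∀ i ω, π.G (i + 1) ω - π.G i ω = max (Y i ω) d) (T : ℝ) (i : ℕ) (ω : Ω) :
    stageExcess p β Y π T (π.G i ω) i ω ≤ (deliveredBefore Y π T i).indicator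
        (fun ω => ∫ s in (Y i ω)..(max (Y i ω) d + Y (i + 1) ω), (p s - β)) ω
      + (crossing Y π T i).indicator (fun ω => cycleBound p β K (Y i ω, Y (i + 1) ω)) ω := by
  by_cases h : π.D Y i ω < T
  · rw [Set.indicator_of_mem (show ω ∈ deliveredBefore Y π T i from h), stageExcess_eq_of_lt h, hG]
    have hτ : Y i ω ≤ T - π.G i ω := by
      rw [Policy.D] at h; linarith
    by_cases h' : π.D Y (i + 1) ω < T
    · rw [Set.indicator_of_notMem (show ω ∉ crossing Y π T i from fun hc => hc.2 h'), add_zero,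
        min_eq_left]
      rw [Policy.D] at h'
      linarith [hG i ω]
    · rw [Set.indicator_of_mem (mem_crossing_of h (not_lt.1 h'))]
      have := abs_integral_min_sub_le (β := β) hp (M.nonneg i ω) (le_max_left (Y i ω) d)
        (M.nonneg (i + 1) ω) (max_le_max_left (Y i ω) hdK) hτ
      linarith [le_of_abs_le this]
  · rw [Set.indicator_of_notMem (show ω ∉ deliveredBefore Y π T i from h),
      M.stageExcess_eq_zero A h]
    have := Set.indicator_nonneg (s := crossing Y π T i)
      (fun ω _ => cycleBound_nonneg (p := p) (β := β) (K := K) (Y i ω, Y (i + 1) ω)) ω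
    linarith

/-- This is the purpose of clipping: an admissible policy may wait for a non-integrable time, but
the clipped cycle is dominated by `cycleBound`. -/
theorem integrable_clipped (M : ServiceModel R P Y μ) (A : Admissible R Y π)
    (h : PenaltyModel μ p) (hK0 : 0 ≤ K) (i : ℕ) :
    Integrable (fun ω => ∫ s in (Y i ω)..(clippedAge Y π K i ω + Y (i + 1) ω), (p s - β)) P := by
  have hm : Measurable (clippedAge Y π K i) :=
    (measurable_clippedAge A K i).mono (M.history_le _) le_rfl
  refine (M.integrable_pair i (h.integrable_cycleBound β hK0)).mono' ?_
    (Eventually.of_forall fun ω => ?_)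
  · exact (h.measurable_integral_interval β (M.meas i)
      (hm.add (M.meas (i + 1)))).aestronglyMeasurable
  · have h1 := M.nonneg i ω
    have h2 := M.nonneg (i + 1) ω
    have h3 := le_clippedAge A K i ω
    have h4 : clippedAge Y π K i ω ≤ max (Y i ω) K := min_le_right _ _
    exact abs_integral_le_cycleBound h.mono h1 (by linarith) (by linarith) (by linarith)

/-- On each inter-delivery interval, the threshold rule is best in conditional expectation. -/
theorem setIntegral_threshold_le (M : ServiceModel R P Y μ) (A : Admissible R Y π)
    (h : PenaltyModel μ p) (hβ : ∃ δ, 0 ≤ δ ∧ β ≤ expPenalty μ p δ) (hK0 : 0 ≤ K)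
    (T : ℝ) (i : ℕ) :
    ∫ ω in deliveredBefore Y π T i,
        (∫ s in (Y i ω)..(max (Y i ω) (ageThreshold μ p β) + Y (i + 1) ω), (p s - β)) ∂P
      ≤ ∫ ω in deliveredBefore Y π T i,
        (∫ s in (Y i ω)..(clippedAge Y π K i ω + Y (i + 1) ω), (p s - β)) ∂P := by
  set d := ageThreshold μ p β with hd
  have hd0 : 0 ≤ d := PenaltyModel.ageThreshold_nonneg
  have hq := h.mono.sub_const_real β
  have i1 := M.integrable_pair i (h.integrable_cycleExcess β hd0)
  have i2 := M.integrable_clipped (β := β) A h hK0 i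
  have hB := M.measurableSet_delivered A T i
  have hBi := A.measurableSet_deliveredBefore T i
  -- `X` collects what is known at the delivery of sample `i`: whether it precedes `T`, its service
  -- time, and the clipped starting age. In `g` only `Y (i + 1)` remains to be averaged.
  let X : Ω → ℝ × ℝ × ℝ := fun ω =>
    ((deliveredBefore Y π T i).indicator (fun _ => (1 : ℝ)) ω, Y i ω, clippedAge Y π K i ω)
  let g : (ℝ × ℝ × ℝ) × ℝ → ℝ := fun u =>
    u.1.1 * ∫ s in (max u.1.2.1 d + u.2)..(u.1.2.2 + u.2), (p s - β)
  have hX : Measurable[history R Y (i + 1)] X := by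
    have h1 : Measurable[history R Y (i + 1)]
        ((deliveredBefore Y π T i).indicator (fun _ => (1 : ℝ))) :=
      measurable_const.indicator hBi
    exact h1.prodMk ((measurable_history i.lt_succ_self).prodMk (measurable_clippedAge A K i))
  have hg : Measurable g := by
    refine (measurable_fst.comp measurable_fst).mul (h.measurable_integral_interval β ?_ ?_) <;>
      fun_prop
  have hgX : (fun ω => g (X ω, Y (i + 1) ω)) = (deliveredBefore Y π T i).indicator fun ω =>
      (∫ s in (Y i ω)..(clippedAge Y π K i ω + Y (i + 1) ω), (p s - β))
        - ∫ s in (Y i ω)..(max (Y i ω) d + Y (i + 1) ω), (p s - β) := by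
    ext ω
    by_cases hω : ω ∈ deliveredBefore Y π T i
    · simp only [g, X, Set.indicator_of_mem hω, one_mul]
      rw [intervalIntegral.integral_interval_sub_left hq.intervalIntegrable hq.intervalIntegrable]
    · simp only [g, X, Set.indicator_of_notMem hω, zero_mul]
  have hnn := M.integral_nonneg_of_history (i + 1) hX hg
    (by rw [hgX]; exact (i2.sub i1).indicator hB) fun ω => by
      simp only [g, X]
      rw [integral_const_mul]
      refine mul_nonneg (Set.indicator_nonneg (fun _ _ => zero_le_one) ω) ?_
      exact h.integral_threshold_le hβ (M.nonneg i ω) (le_clippedAge A K i ω)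
  rw [hgX, integral_indicator hB, integral_sub i2.integrableOn i1.integrableOn] at hnn
  exact sub_nonneg.1 hnn

/-- The part of the error that does not depend on the horizon. -/
def _root_.AoI.baseError (μ : Measure ℝ) (p : ℝ → ℝ) (β K : ℝ) : ℝ :=
  (∫ y, (∫ s in (0 : ℝ)..(K + y), |p s - β|) ∂μ) + ∫ z, cycleBound p β K z ∂(μ.prod μ)

/-- The root equation says precisely that a threshold cycle has mean excess zero, so the estimate
for centered functions applies. -/
theorem abs_sum_threshold_le (M : ServiceModel R P Y μ) (A : Admissible R Y π)
    (h : PenaltyModel μ p) (hroot : thresholdExcess μ p β = 0) (hK0 : 0 ≤ K)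
    (hdK : ageThreshold μ p β ≤ K) {L T : ℝ} (hL : 0 ≤ L) (hT : 0 ≤ T) (n : ℕ) :
    |∑ i ∈ Finset.range n, ∫ ω in deliveredBefore Y π T i,
        (∫ s in (Y i ω)..(max (Y i ω) (ageThreshold μ p β) + Y (i + 1) ω), (p s - β)) ∂P|
      ≤ (∫ z, cycleBound p β K z ∂(μ.prod μ)) + horizonError μ (cycleBound p β K) L T := by
  refine M.abs_sum_setIntegral_le A (measurable_cycleBound h.mono) cycleBound_nonneg
    (h.integrable_cycleBound β hK0) h.integral_min_one_pos
    (c := fun z => ∫ s in z.1..(max z.1 (ageThreshold μ p β) + z.2), (p s - β))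
    (h.measurable_integral_interval β (by fun_prop) (by fun_prop)) hroot ?_ hL hT n
  filter_upwards [h.nonneg_prod] with z hz
  have h1 := le_max_left z.1 (ageThreshold μ p β)
  have h2 := max_le_max_left z.1 hdK
  exact abs_integral_le_cycleBound h.mono hz.1 (by linarith [hz.1, hz.2]) (by linarith [hz.2])
    (by linarith)

theorem integral_firstError (M : ServiceModel R P Y μ) (h : PenaltyModel μ p) :
    ∫ ω, (∫ s in (0 : ℝ)..(K + Y 0 ω), |p s - β|) ∂P
      = ∫ y, (∫ s in (0 : ℝ)..(K + y), |p s - β|) ∂μ :=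
  M.integral_single 0 ((continuous_integral_abs_of_monotone (h.mono.sub_const_real β)).comp
    (by fun_prop : Continuous fun y : ℝ => K + y)).measurable

/-- Every admissible policy accumulates at least the rate `β`, up to an error. -/
theorem neg_error_le_integral (M : ServiceModel R P Y μ) (A : Admissible R Y π)
    (h : PenaltyModel μ p) (ha₀ : 0 ≤ a₀) (hβ : ∃ δ, 0 ≤ δ ∧ β ≤ expPenalty μ p δ)
    (hroot : thresholdExcess μ p β = 0) (ha₀K : a₀ ≤ K) (hdK : ageThreshold μ p β ≤ K)
    (hK : ∀ s, K ≤ s → β ≤ p s) {L T : ℝ} (hL : 0 ≤ L) (hT : 0 ≤ T) :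
    -(baseError μ p β K + 2 * horizonError μ (cycleBound p β K) L T)
      ≤ ∫ ω, (∫ t in (0 : ℝ)..T, (p (age a₀ Y π ω t) - β)) ∂P := by
  have hK0 : 0 ≤ K := ha₀.trans ha₀K
  -- The estimate is proved for the first `n` cycles at fixed `T`, and `n → ∞` removes the remainder
  -- after the `n`-th delivery.
  have hlim : Tendsto (fun n => -(baseError μ p β K
        + 2 * horizonError μ (cycleBound p β K) L T)
        - P.real (deliveredBefore Y π T n) * (excessBound p β a₀ T * T)) atTop
      (nhds (-(baseError μ p β K + 2 * horizonError μ (cycleBound p β K) L T) - 0 * _)) :=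
    tendsto_const_nhds.sub
      ((M.tendsto_measureReal_delivered A h.integral_min_one_pos hT).mul_const _)
  rw [zero_mul, sub_zero] at hlim
  refine le_of_tendsto hlim (Eventually.of_forall fun n => ?_)
  have hB := fun i => M.measurableSet_delivered A T i
  have hC := fun i => M.measurableSet_crossing A T i
  have ie := fun i => M.integrable_pair i (h.integrable_cycleBound β hK0)
  have iv := fun i => M.integrable_clipped (β := β) A h hK0 i
  have i0 := M.integrable_single 0 (h.integrable_integral_abs_add β hK0)
  have iB : Integrable ((deliveredBefore Y π T n).indicator
      fun _ => excessBound p β a₀ T * T) P := (integrable_const _).indicator (hB n)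
  have it : ∀ i, Integrable (fun ω => (deliveredBefore Y π T i).indicator
        (fun ω => ∫ s in (Y i ω)..(clippedAge Y π K i ω + Y (i + 1) ω), (p s - β)) ω
      - (crossing Y π T i).indicator (fun ω => cycleBound p β K (Y i ω, Y (i + 1) ω)) ω) P :=
    fun i => ((iv i).indicator (hB i)).sub ((ie i).indicator (hC i))
  have isum := integrable_finsetSum (Finset.range n) fun i _ => it i
  have hpath : ∀ ω, (∑ i ∈ Finset.range n, ((deliveredBefore Y π T i).indicator
        (fun ω => ∫ s in (Y i ω)..(clippedAge Y π K i ω + Y (i + 1) ω), (p s - β)) ω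
      - (crossing Y π T i).indicator (fun ω => cycleBound p β K (Y i ω, Y (i + 1) ω)) ω))
      - ((∫ s in (0 : ℝ)..(K + Y 0 ω), |p s - β|)
        + (deliveredBefore Y π T n).indicator (fun _ => excessBound p β a₀ T * T) ω)
      ≤ ∫ t in (0 : ℝ)..T, (p (age a₀ Y π ω t) - β) := by
    intro ω
    have h1 := M.abs_integral_age_sub_sum_le (β := β) A h.mono ha₀ ha₀K hT n ω
    have h2 := Finset.sum_le_sum fun i (_ : i ∈ Finset.range n) =>
      M.indicator_sub_le_stageExcess A h.mono hK T i ω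
    linarith [neg_le_of_abs_le h1]
  have hmain := integral_mono (isum.sub (i0.add iB))
    (M.integrable_integral_excess_age (β := β) A h.mono ha₀ hT) hpath
  refine le_trans ?_ hmain
  have e1 : ∫ ω, ((∑ i ∈ Finset.range n, ((deliveredBefore Y π T i).indicator
        (fun ω => ∫ s in (Y i ω)..(clippedAge Y π K i ω + Y (i + 1) ω), (p s - β)) ω
      - (crossing Y π T i).indicator (fun ω => cycleBound p β K (Y i ω, Y (i + 1) ω)) ω))
      - ((∫ s in (0 : ℝ)..(K + Y 0 ω), |p s - β|)
        + (deliveredBefore Y π T n).indicator (fun _ => excessBound p β a₀ T * T) ω)) ∂P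
      = (∑ i ∈ Finset.range n, ((∫ ω in deliveredBefore Y π T i,
          (∫ s in (Y i ω)..(clippedAge Y π K i ω + Y (i + 1) ω), (p s - β)) ∂P)
        - ∫ ω in crossing Y π T i, cycleBound p β K (Y i ω, Y (i + 1) ω) ∂P))
        - ((∫ y, (∫ s in (0 : ℝ)..(K + y), |p s - β|) ∂μ)
          + P.real (deliveredBefore Y π T n) * (excessBound p β a₀ T * T)) := by
    rw [integral_sub (by exact isum) (by exact i0.add iB),
      integral_finsetSum _ (fun i _ => it i),
      integral_add i0 iB, M.integral_firstError h, integral_indicator (hB n), setIntegral_const,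
      smul_eq_mul]
    congr 1
    refine Finset.sum_congr rfl fun i _ => ?_
    rw [integral_sub ((iv i).indicator (hB i)) ((ie i).indicator (hC i)),
      integral_indicator (hB i), integral_indicator (hC i)]
  refine le_of_le_of_eq ?_ e1.symm
  rw [Finset.sum_sub_distrib]
  -- Each clipped cycle is at least a threshold cycle in mean, threshold cycles nearly cancel at the
  -- root, and the crossing terms cost one more horizon error.
  have h1 := Finset.sum_le_sum fun i (_ : i ∈ Finset.range n) =>
    M.setIntegral_threshold_le A h hβ hK0 T i
  have h2 := neg_le_of_abs_le (M.abs_sum_threshold_le A h hroot hK0 hdK hL hT n)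
  have h3 := M.sum_crossing_le A (measurable_cycleBound h.mono) cycleBound_nonneg
    (h.integrable_cycleBound β hK0) h.integral_min_one_pos hL hT n
  rw [baseError]
  linarith

/-- The threshold policy accumulates at most the rate `β`, up to an error. -/
theorem integral_le_error (M : ServiceModel R P Y μ) (A : Admissible R Y π)
    (h : PenaltyModel μ p) (ha₀ : 0 ≤ a₀)
    (hroot : thresholdExcess μ p β = 0) (ha₀K : a₀ ≤ K) (hdK : ageThreshold μ p β ≤ K)
    (hSG : ∀ i ω, π.S i ω = π.G i ω)
    (hG : ∀ i ω, π.G (i + 1) ω - π.G i ω = max (Y i ω) (ageThreshold μ p β))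
    {L T : ℝ} (hL : 0 ≤ L) (hT : 0 ≤ T) :
    ∫ ω, (∫ t in (0 : ℝ)..T, (p (age a₀ Y π ω t) - β)) ∂P
      ≤ baseError μ p β K + 2 * horizonError μ (cycleBound p β K) L T := by
  have hK0 : 0 ≤ K := ha₀.trans ha₀K
  have hlim : Tendsto (fun n => (baseError μ p β K
        + 2 * horizonError μ (cycleBound p β K) L T)
        + P.real (deliveredBefore Y π T n) * (excessBound p β a₀ T * T)) atTop
      (nhds ((baseError μ p β K + 2 * horizonError μ (cycleBound p β K) L T) + 0 * _)) :=
    tendsto_const_nhds.add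
      ((M.tendsto_measureReal_delivered A h.integral_min_one_pos hT).mul_const _)
  rw [zero_mul, add_zero] at hlim
  refine ge_of_tendsto hlim (Eventually.of_forall fun n => ?_)
  set d := ageThreshold μ p β with hd
  have hB := fun i => M.measurableSet_delivered A T i
  have hC := fun i => M.measurableSet_crossing A T i
  have ie := fun i => M.integrable_pair i (h.integrable_cycleBound β hK0)
  have iv := fun i => M.integrable_pair i
    (h.integrable_cycleExcess β (PenaltyModel.ageThreshold_nonneg (μ := μ) (p := p) (β := β)))
  have i0 := M.integrable_single 0 (h.integrable_integral_abs_add β hK0)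
  have iB : Integrable ((deliveredBefore Y π T n).indicator
      fun _ => excessBound p β a₀ T * T) P := (integrable_const _).indicator (hB n)
  have it : ∀ i, Integrable (fun ω => (deliveredBefore Y π T i).indicator
        (fun ω => ∫ s in (Y i ω)..(max (Y i ω) d + Y (i + 1) ω), (p s - β)) ω
      + (crossing Y π T i).indicator (fun ω => cycleBound p β K (Y i ω, Y (i + 1) ω)) ω) P :=
    fun i => ((iv i).indicator (hB i)).add ((ie i).indicator (hC i))
  have isum := integrable_finsetSum (Finset.range n) fun i _ => it i
  have hpath : ∀ ω, ∫ t in (0 : ℝ)..T, (p (age a₀ Y π ω t) - β)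
      ≤ (∑ i ∈ Finset.range n, ((deliveredBefore Y π T i).indicator
        (fun ω => ∫ s in (Y i ω)..(max (Y i ω) d + Y (i + 1) ω), (p s - β)) ω
      + (crossing Y π T i).indicator (fun ω => cycleBound p β K (Y i ω, Y (i + 1) ω)) ω))
      + ((∫ s in (0 : ℝ)..(K + Y 0 ω), |p s - β|)
        + (deliveredBefore Y π T n).indicator (fun _ => excessBound p β a₀ T * T) ω) := by
    intro ω
    have h1 := M.abs_integral_age_sub_sum_le (β := β) A h.mono ha₀ ha₀K hT n ω
    simp_rw [hSG] at h1
    have h2 := Finset.sum_le_sum fun i (_ : i ∈ Finset.range n) =>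
      M.stageExcess_le_indicator_add (β := β) A h.mono hdK hG T i ω
    linarith [le_of_abs_le h1]
  have hmain := integral_mono (M.integrable_integral_excess_age (β := β) A h.mono ha₀ hT)
    (isum.add (i0.add iB)) hpath
  refine hmain.trans ?_
  have e1 : ∫ ω, ((∑ i ∈ Finset.range n, ((deliveredBefore Y π T i).indicator
        (fun ω => ∫ s in (Y i ω)..(max (Y i ω) d + Y (i + 1) ω), (p s - β)) ω
      + (crossing Y π T i).indicator (fun ω => cycleBound p β K (Y i ω, Y (i + 1) ω)) ω))
      + ((∫ s in (0 : ℝ)..(K + Y 0 ω), |p s - β|)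
        + (deliveredBefore Y π T n).indicator (fun _ => excessBound p β a₀ T * T) ω)) ∂P
      = (∑ i ∈ Finset.range n, ((∫ ω in deliveredBefore Y π T i,
          (∫ s in (Y i ω)..(max (Y i ω) d + Y (i + 1) ω), (p s - β)) ∂P)
        + ∫ ω in crossing Y π T i, cycleBound p β K (Y i ω, Y (i + 1) ω) ∂P))
        + ((∫ y, (∫ s in (0 : ℝ)..(K + y), |p s - β|) ∂μ)
          + P.real (deliveredBefore Y π T n) * (excessBound p β a₀ T * T)) := by
    rw [integral_add (by exact isum) (by exact i0.add iB),
      integral_finsetSum _ (fun i _ => it i),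
      integral_add i0 iB, M.integral_firstError h, integral_indicator (hB n), setIntegral_const,
      smul_eq_mul]
    congr 1
    refine Finset.sum_congr rfl fun i _ => ?_
    rw [integral_add ((iv i).indicator (hB i)) ((ie i).indicator (hC i)),
      integral_indicator (hB i), integral_indicator (hC i)]
  refine le_of_eq_of_le e1 ?_
  rw [Finset.sum_add_distrib]
  have h2 := le_of_abs_le (M.abs_sum_threshold_le A h hroot hK0 hdK hL hT n)
  have h3 := M.sum_crossing_le A (measurable_cycleBound h.mono) cycleBound_nonneg
    (h.integrable_cycleBound β hK0) h.integral_min_one_pos hL hT n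
  rw [baseError]
  linarith

end ServiceModel

/-! ### Long-run averages -/

/-- The level `L` is chosen first, so that the tail mean per delivery is small; only then does `T`
grow. The error is thus `o(T)` assuming only an integrable cycle bound. -/
theorem eventually_error_le {μ : Measure ℝ} [IsProbabilityMeasure μ] {p : ℝ → ℝ} {β K : ℝ}
    (h : PenaltyModel μ p) (hK0 : 0 ≤ K) {ε : ℝ} (hε : 0 < ε) : ∃ L, 0 ≤ L ∧ ∀ᶠ T : ℝ in atTop,
      baseError μ p β K + 2 * horizonError μ (cycleBound p β K) L T ≤ ε * T := by
  have hc := h.integral_min_one_pos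
  set c := ∫ y, min y 1 ∂μ with hcdef
  have htail := tendsto_integral_tailPart (measurable_cycleBound h.mono)
    (h.integrable_cycleBound β hK0)
  -- With tail mean `η < ε * c / 4`, the doubled horizon error grows at most like `ε / 2 * T`; the
  -- other half of `ε * T` absorbs the constants.
  have hpos : 0 < ε * c / 4 := by positivity
  obtain ⟨L, hLη, hL⟩ := ((htail.eventually (gt_mem_nhds hpos)).and (eventually_ge_atTop 0)).exists
  set η := ∫ z, tailPart (cycleBound p β K) L z ∂(μ.prod μ) with hη
  have hη2 : η / c ≤ ε / 4 := by
    rw [div_le_iff₀ hc]; linarith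
  refine ⟨L, hL, ?_⟩
  filter_upwards [eventually_ge_atTop 0,
    eventually_ge_atTop ((baseError μ p β K + 2 * L + 2 * η + 2 * (η / c)) * (2 / ε))]
    with T hT0 hT
  have h1 : horizonError μ (cycleBound p β K) L T = L + η + η / c + η / c * T := by
    rw [horizonError, ← hcdef, ← hη]; ring
  have h2 : η / c * T ≤ ε / 4 * T := mul_le_mul_of_nonneg_right hη2 hT0
  have h3 : baseError μ p β K + 2 * L + 2 * η + 2 * (η / c) ≤ ε / 2 * T := by
    have := mul_le_mul_of_nonneg_left hT (by positivity : (0 : ℝ) ≤ ε / 2)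
    refine le_of_eq_of_le ?_ this
    field_simp
  rw [h1]
  linarith

namespace ServiceModel

variable {Ω : Type*} {R : MeasurableSpace Ω} [mΩ : MeasurableSpace Ω] {P : Measure Ω}
  [IsProbabilityMeasure P] {Y : ℕ → Ω → ℝ} {μ : Measure ℝ} [IsProbabilityMeasure μ]
  {π : Policy Ω} {a₀ : ℝ} {p p₀ : ℝ → ℝ} {β : ℝ}

/-- Ages are nonnegative, so the original penalty `p₀` and its monotone extension `p` give the same
average. Subtracting `β` then shifts this average by `β`. -/
theorem average_eq (M : ServiceModel R P Y μ) (A : Admissible R Y π) (hp : Monotone p)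
    (hp₀ : ∀ s, 0 ≤ s → p₀ s = p s) (ha₀ : 0 ≤ a₀) (β : ℝ) {T : ℝ} (hT : 0 < T) :
    ∫ ω, ((1 / T) * ∫ t in (0 : ℝ)..T, p₀ (age a₀ Y π ω t)) ∂P
      = (1 / T) * (∫ ω, (∫ t in (0 : ℝ)..T, (p (age a₀ Y π ω t) - β)) ∂P) + β := by
  have hω : ∀ ω, (1 / T) * ∫ t in (0 : ℝ)..T, p₀ (age a₀ Y π ω t)
      = (1 / T) * (∫ t in (0 : ℝ)..T, (p (age a₀ Y π ω t) - β)) + β := by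
    intro ω
    have h0 : ∫ t in (0 : ℝ)..T, p₀ (age a₀ Y π ω t)
        = ∫ t in (0 : ℝ)..T, ((p (age a₀ Y π ω t) - β) + β) := by
      refine intervalIntegral.integral_congr fun t ht => ?_
      rw [Set.uIcc_of_le hT.le] at ht
      rw [hp₀ _ (M.age_nonneg A ha₀ ht.1), sub_add_cancel]
    rw [h0, intervalIntegral.integral_add
      (M.intervalIntegrable_excess_age A hp ha₀ ω le_rfl hT.le) (by simp),
      intervalIntegral.integral_const, smul_eq_mul]
    field_simp
    ring
  simp_rw [hω]
  rw [integral_add ((M.integrable_integral_excess_age A hp ha₀ hT.le).const_mul _)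
    (integrable_const _), integral_const_mul]
  simp

theorem exists_level (h : PenaltyModel μ p) (a₀ : ℝ)
    (hβ : ∃ δ, 0 ≤ δ ∧ β ≤ expPenalty μ p δ) :
    ∃ K, a₀ ≤ K ∧ ageThreshold μ p β ≤ K ∧ ∀ s, K ≤ s → β ≤ p s := by
  obtain ⟨δ, hδ, hβδ⟩ := hβ
  obtain ⟨s₀, -, hs₀⟩ := h.exists_le_penalty hδ hβδ
  refine ⟨max s₀ (max a₀ (ageThreshold μ p β)), ?_, ?_, fun s hs => ?_⟩
  · exact (le_max_left _ _).trans (le_max_right _ _)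
  · exact (le_max_right _ _).trans (le_max_right _ _)
  · exact hs₀.trans (h.mono ((le_max_left _ _).trans hs))

/-- No admissible policy has a smaller long-run average than the root `β`. -/
theorem le_cost (M : ServiceModel R P Y μ) (A : Admissible R Y π) (h : PenaltyModel μ p)
    (hp₀ : ∀ s, 0 ≤ s → p₀ s = p s) (ha₀ : 0 ≤ a₀)
    (hβ : ∃ δ, 0 ≤ δ ∧ β ≤ expPenalty μ p δ) (hroot : thresholdExcess μ p β = 0) :
    (β : EReal) ≤ cost P p₀ a₀ Y π := by
  obtain ⟨K, ha₀K, hdK, hK⟩ := exists_level h a₀ hβ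
  refine EReal.ge_of_forall_gt_iff_ge.1 fun z hz => ?_
  have hz' : z < β := by exact_mod_cast hz
  obtain ⟨L, hL, hev⟩ := eventually_error_le (β := β) h (ha₀.trans ha₀K) (sub_pos.2 hz')
  -- The bound holds for all large `T`, so it bounds even the lower limit.
  refine le_trans (le_liminf_of_le (by isBoundedDefault) ?_) liminf_le_limsup
  filter_upwards [hev, eventually_gt_atTop 0] with T hT hT0
  rw [M.average_eq A h.mono hp₀ ha₀ β hT0, EReal.coe_le_coe_iff]
  have hI := (neg_le_neg hT).trans (M.neg_error_le_integral A h ha₀ hβ hroot ha₀K hdK hK hL hT0.le)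
  have := mul_le_mul_of_nonneg_left hI (one_div_pos.2 hT0).le
  have he : 1 / T * -((β - z) * T) = z - β := by field_simp; ring
  linarith

/-- The threshold policy has the root `β` as long-run average. -/
theorem cost_le (M : ServiceModel R P Y μ) (A : Admissible R Y π) (h : PenaltyModel μ p)
    (hp₀ : ∀ s, 0 ≤ s → p₀ s = p s) (ha₀ : 0 ≤ a₀)
    (hβ : ∃ δ, 0 ≤ δ ∧ β ≤ expPenalty μ p δ) (hroot : thresholdExcess μ p β = 0)
    (hSG : ∀ i ω, π.S i ω = π.G i ω)
    (hG : ∀ i ω, π.G (i + 1) ω - π.G i ω = max (Y i ω) (ageThreshold μ p β)) :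
    cost P p₀ a₀ Y π ≤ (β : EReal) := by
  obtain ⟨K, ha₀K, hdK, -⟩ := exists_level h a₀ hβ
  refine EReal.le_of_forall_lt_iff_le.1 fun z hz => ?_
  have hz' : β < z := by exact_mod_cast hz
  obtain ⟨L, hL, hev⟩ := eventually_error_le (β := β) h (ha₀.trans ha₀K) (sub_pos.2 hz')
  refine limsup_le_of_le (by isBoundedDefault) ?_
  filter_upwards [hev, eventually_gt_atTop 0] with T hT hT0
  rw [M.average_eq A h.mono hp₀ ha₀ β hT0, EReal.coe_le_coe_iff]
  have hI := (M.integral_le_error A h ha₀ hroot ha₀K hdK hSG hG hL hT0.le).trans hT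
  have := mul_le_mul_of_nonneg_left hI (one_div_pos.2 hT0).le
  have he : 1 / T * ((z - β) * T) = z - β := by field_simp
  linarith

/-! ### Waiting policies -/

/-- Sampling at the first time after the delivery at which the age is at least `d`. -/
structure _root_.AoI.WaitsUntil (Y : ℕ → Ω → ℝ) (S : ℕ → Ω → ℝ) (d : ℝ) : Prop where
  zero : ∀ ω, S 0 ω = 0
  succ : ∀ i ω, S (i + 1) ω = S i ω + max (Y i ω) d

variable {S : ℕ → Ω → ℝ} {d : ℝ}

theorem waitsUntil_waitSampling (Y : ℕ → Ω → ℝ) (d : ℝ) : WaitsUntil Y (waitSampling Y d) d where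
  zero _ := rfl
  succ i ω := by
    change waitSampling Y d i ω + Y i ω + max (d - Y i ω) 0 = _
    have : max (Y i ω) d = Y i ω + max (d - Y i ω) 0 := by
      rw [← max_add_add_left, add_sub_cancel, add_zero, max_comm]
    rw [this]; ring

theorem admissible_ofSampling (M : ServiceModel R P Y μ) (hS : WaitsUntil Y S d) :
    Admissible R Y (Policy.ofSampling S) := by
  have hY : ∀ i ω, S i ω + Y i ω ≤ S (i + 1) ω := fun i ω => by
    rw [hS.succ]; linarith [le_max_left (Y i ω) d]
  have hmono : ∀ ω, Monotone fun i => S i ω := fun ω =>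
    monotone_nat_of_le_succ fun i => by linarith [hY i ω, M.nonneg i ω]
  have hmeas : ∀ i, Measurable[history R Y i] (S i) := by
    intro i
    induction i with
    | zero =>
      have : S 0 = fun _ => 0 := funext hS.zero
      rw [this]; exact measurable_const
    | succ i ih =>
      have : S (i + 1) = fun ω => S i ω + max (Y i ω) d := funext (hS.succ i)
      rw [this]
      have h1 := ih.mono (history_mono i.le_succ) le_rfl
      have h2 : Measurable[history R Y (i + 1)] (Y i) := measurable_history i.lt_succ_self
      exact h1.add (h2.max measurable_const)
  -- For the last clause the witness is the empty event: no later sample is taken before sample `j`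
  -- is delivered.
  refine ⟨hS.zero, hS.zero, fun i ω => hmono ω i.le_succ, fun i ω => le_rfl, hY, hmeas, hmeas,
    fun i j hji t => ⟨∅, @MeasurableSet.empty _ (history R Y j), ?_⟩⟩
  rw [Set.empty_inter, Set.eq_empty_iff_forall_notMem]
  rintro ω ⟨h1, h2⟩
  have h3 : S (j + 1) ω ≤ S i ω := hmono ω hji
  have h4 := hY j ω
  simp only [Policy.D, Policy.ofSampling] at h1 h2
  linarith

/-! ### Cycle means, threshold rule and index rule in terms of the law `μ` -/

theorem meanLength_eq (M : ServiceModel R P Y μ) (hS : WaitsUntil Y S d) (k : ℕ) :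
    meanLength P Y S k = cycleLength μ d := by
  rw [cycleLength, ← M.integral_pair k (by fun_prop), meanLength]
  refine integral_congr_ae (Eventually.of_forall fun ω => ?_)
  simp only [hS.succ]
  ring

theorem meanCyclePenalty_eq (M : ServiceModel R P Y μ) (hp : Monotone p)
    (hp₀ : ∀ s, 0 ≤ s → p₀ s = p s) (hS : WaitsUntil Y S d) (k : ℕ) :
    meanCyclePenalty P p₀ Y S k = cyclePenalty μ p d := by
  have hm : Measurable fun z : ℝ × ℝ => ∫ s in z.1..(max z.1 d + z.2), p s := by
    have hc := (continuous_integral_of_monotone hp).measurable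
    convert (hc.comp (by fun_prop : Measurable fun z : ℝ × ℝ => max z.1 d + z.2)).sub
      (hc.comp measurable_fst) using 2 with z
    exact integral_eq_sub_of_monotone hp _ _
  rw [cyclePenalty, ← M.integral_pair k hm, meanCyclePenalty]
  refine integral_congr_ae (Eventually.of_forall fun ω => ?_)
  have h1 := M.nonneg k ω
  have h2 := M.nonneg (k + 1) ω
  have h3 := le_max_left (Y k ω) d
  simp only [hS.succ]
  rw [intervalIntegral.integral_comp_sub_right]
  have e1 : S k ω + Y k ω - S k ω = Y k ω := by ring
  have e2 : S k ω + max (Y k ω) d + Y (k + 1) ω - S k ω = max (Y k ω) d + Y (k + 1) ω := by ring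
  rw [e1, e2]
  refine intervalIntegral.integral_congr fun s hs => ?_
  rw [Set.uIcc_of_le (by linarith)] at hs
  exact hp₀ s (h1.trans hs.1)

theorem meanPenalty_eq (M : ServiceModel R P Y μ) (hp : Monotone p)
    (hp₀ : ∀ s, 0 ≤ s → p₀ s = p s) (k : ℕ) {δ : ℝ} (hδ : 0 ≤ δ) :
    meanPenalty P p₀ (Y k) δ = expPenalty μ p δ := by
  rw [expPenalty, ← M.integral_single (φ := fun y => p (δ + y)) k
    (hp.measurable.comp (measurable_const_add δ)), meanPenalty]
  exact integral_congr_ae (Eventually.of_forall fun ω => hp₀ _ (add_nonneg hδ (M.nonneg k ω)))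

/-- The expected penalty may jump, so the infimum over sampling times need not be attained.
Membership is therefore shown only for times strictly past the threshold, which suffices to identify
the infimum. -/
theorem waitsUntil_thresholdSampling (M : ServiceModel R P Y μ) (h : PenaltyModel μ p)
    (hp₀ : ∀ s, 0 ≤ s → p₀ s = p s) (hβ : ∃ δ, 0 ≤ δ ∧ β ≤ expPenalty μ p δ) :
    WaitsUntil Y (thresholdSampling P p₀ Y β) (ageThreshold μ p β) := by
  refine ⟨fun _ => rfl, fun i ω => ?_⟩
  set d := ageThreshold μ p β with hd
  rw [thresholdSampling]
  set s := thresholdSampling P p₀ Y β i ω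
  have hY := M.nonneg i ω
  have hmem : ∀ t, s + max (Y i ω) d < t → t ∈ {t : ℝ | s + Y i ω ≤ t ∧
      β ≤ meanPenalty P p₀ (Y (i + 1)) (t - s)} := by
    intro t ht
    have h1 := le_max_left (Y i ω) d
    have h2 := le_max_right (Y i ω) d
    refine ⟨by linarith, ?_⟩
    rw [M.meanPenalty_eq h.mono hp₀ (i + 1) (by linarith)]
    exact h.le_of_ageThreshold_lt hβ (by linarith)
  refine csInf_eq_of_forall_ge_of_forall_gt_exists_lt
    ⟨s + max (Y i ω) d + 1, hmem _ (lt_add_one _)⟩ ?_ fun w hw => ?_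
  · rintro t ⟨h1, h2⟩
    rw [M.meanPenalty_eq h.mono hp₀ (i + 1) (by linarith)] at h2
    have h3 := PenaltyModel.ageThreshold_le (by linarith : 0 ≤ t - s) h2
    have := max_le (by linarith : Y i ω ≤ t - s) h3
    linarith
  · obtain ⟨t, ht1, ht2⟩ := exists_between hw
    exact ⟨t, hmem t ht1, ht2⟩

theorem isThresholdRoot_iff (M : ServiceModel R P Y μ) (h : PenaltyModel μ p)
    (hp₀ : ∀ s, 0 ≤ s → p₀ s = p s) (k : ℕ) :
    IsThresholdRoot P p₀ Y k β
      ↔ (∃ δ, 0 ≤ δ ∧ β ≤ expPenalty μ p δ) ∧ thresholdExcess μ p β = 0 := by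
  have h1 : (∃ δ : ℝ, 0 ≤ δ ∧ β ≤ meanPenalty P p₀ (Y (k + 1)) δ)
      ↔ ∃ δ, 0 ≤ δ ∧ β ≤ expPenalty μ p δ :=
    exists_congr fun δ => and_congr_right fun hδ => by rw [M.meanPenalty_eq h.mono hp₀ _ hδ]
  rw [IsThresholdRoot, h1]
  refine and_congr_right fun hβ => ?_
  have hS := M.waitsUntil_thresholdSampling h hp₀ hβ
  rw [M.meanCyclePenalty_eq h.mono hp₀ hS, M.meanLength_eq hS, thresholdExcess,
    h.cycleExcess_eq β PenaltyModel.ageThreshold_nonneg]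

theorem whittleIndex_nonneg_iff (M : ServiceModel R P Y μ) (h : PenaltyModel μ p)
    (hp₀ : ∀ s, 0 ≤ s → p₀ s = p s) (hβ : ∃ δ, 0 ≤ δ ∧ β ≤ expPenalty μ p δ)
    (hroot : thresholdExcess μ p β = 0) (k : ℕ) {δ : ℝ} (hδ : 0 ≤ δ) :
    0 ≤ whittleIndex P p₀ Y k δ 0 ↔ β ≤ expPenalty μ p δ := by
  have hS := waitsUntil_waitSampling Y δ
  have hmean : ∫ ω, Y k ω ∂P = ∫ y, y ∂μ := M.integral_single k measurable_id
  rw [whittleIndex, if_neg (lt_irrefl 0), M.meanLength_eq hS, M.meanCyclePenalty_eq h.mono hp₀ hS,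
    M.meanPenalty_eq h.mono hp₀ _ hδ, hmean, EReal.coe_nonneg,
    mul_nonneg_iff_of_pos_left (one_div_pos.2 h.mean_pos)]
  exact h.index_nonneg_iff hβ hroot hδ

/-- By induction both rules take the infimum of the same set of times: the index is `⊥` during
service, and after delivery its sign is decided by the threshold condition. -/
theorem whittleSampling_eq (M : ServiceModel R P Y μ) (h : PenaltyModel μ p)
    (hp₀ : ∀ s, 0 ≤ s → p₀ s = p s) (hβ : ∃ δ, 0 ≤ δ ∧ β ≤ expPenalty μ p δ)
    (hroot : thresholdExcess μ p β = 0) (k i : ℕ) (ω : Ω) :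
    whittleSampling P p₀ a₀ Y k i ω = thresholdSampling P p₀ Y β i ω := by
  induction i with
  | zero => rfl
  | succ i ih =>
    rw [whittleSampling] at ih
    rw [whittleSampling, whittlePair, thresholdSampling]
    simp only [ih]
    congr 1
    ext t
    set s := thresholdSampling P p₀ Y β i ω
    set u := (whittlePair P p₀ a₀ Y k i ω).1
    have hY := M.nonneg i ω
    simp only [Set.mem_ofPred_eq]
    by_cases ht : s + Y i ω ≤ t
    · have hst : s ≤ t := by linarith
      rw [serviceTime, if_neg (fun hc => not_lt.2 ht hc.2), currentAge, if_neg (not_lt.2 ht),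
        M.whittleIndex_nonneg_iff h hp₀ hβ hroot k (sub_nonneg.2 hst),
        M.meanPenalty_eq h.mono hp₀ _ (sub_nonneg.2 hst)]
      exact ⟨fun hc => ⟨ht, hc.2⟩, fun hc => ⟨hst, hc.2⟩⟩
    · refine iff_of_false (fun hc => ?_) fun hc => ht hc.1
      -- The starting instant `t = s` is covered as well, thanks to the positive value assigned
      -- there.
      have hpos : 0 < serviceTime s (Y i ω) t := by
        rw [serviceTime, if_pos ⟨hc.1, not_le.1 ht⟩]
        split_ifs with hts
        · exact one_pos
        · exact sub_pos.2 (lt_of_le_of_ne hc.1 (Ne.symm hts))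
      have := hc.2
      rw [whittleIndex, if_pos hpos] at this
      simp at this

end ServiceModel

/-- The law of the transmission times and the penalty, extended by its value at `0`, form a
penalty model. -/
theorem penaltyModel_extend {Ω : Type*} {R : MeasurableSpace Ω} [MeasurableSpace Ω]
    {P : Measure Ω} [IsProbabilityMeasure P] {Y : ℕ → Ω → ℝ} {μ : Measure ℝ}
    (M : ServiceModel R P Y μ) (hint : Integrable (Y 0) P) (hpos : 0 < ∫ ω, Y 0 ω ∂P)
    {p : ℝ → ℝ} (hp : StrictMonoOn p (Set.Ici 0))
    (hp_int : Integrable (fun ω => ∫ s in (0 : ℝ)..(Y 0 ω + Y 1 ω), p s) P) :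
    PenaltyModel μ (fun s => p (max s 0)) := by
  have hmono : Monotone fun s => p (max s 0) := fun a b hab =>
    hp.monotoneOn (le_max_right a 0) (le_max_right b 0) (max_le_max_right 0 hab)
  refine ⟨hmono, fun a ha b hb hab => ?_, ?_, ?_, ?_, ?_⟩
  · simp only [max_eq_left (Set.mem_Ici.1 ha), max_eq_left (Set.mem_Ici.1 hb)]
    exact hp ha hb hab
  · rw [← M.map_eq 0, ae_map_iff (M.meas 0).aemeasurable measurableSet_Ici]
    exact Eventually.of_forall fun ω => M.nonneg 0 ω
  · rw [← M.map_eq 0]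
    exact (integrable_map_measure aestronglyMeasurable_id (M.meas 0).aemeasurable).2 hint
  · exact hpos.trans_eq (M.integral_single 0 measurable_id)
  · have hm : Measurable fun z : ℝ × ℝ => ∫ s in (0 : ℝ)..(z.1 + z.2), p (max s 0) :=
      ((continuous_integral_of_monotone hmono).comp
        (by fun_prop : Continuous fun z : ℝ × ℝ => z.1 + z.2)).measurable
    rw [← M.map_pair 0, integrable_map_measure hm.aestronglyMeasurable
      (M.measurable_pair 0).aemeasurable]
    refine hp_int.congr (Eventually.of_forall fun ω => ?_)
    refine intervalIntegral.integral_congr fun s hs => ?_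
    rw [Set.uIcc_of_le (add_nonneg (M.nonneg 0 ω) (M.nonneg 1 ω))] at hs
    simp only [max_eq_left hs.1]

end AoI

end

/-! ### The theorem -/

theorem theorem6 {Ω : Type*} (R : MeasurableSpace Ω) [mΩ : MeasurableSpace Ω]
    (P : Measure Ω) [IsProbabilityMeasure P]
    (Y : ℕ → Ω → ℝ)
    (hY_meas : ∀ i, Measurable (Y i))
    (hY_nonneg : ∀ i ω, 0 ≤ Y i ω)
    (hY_indep : iIndepFun Y P)
    (hY_ident : ∀ i, IdentDistrib (Y i) (Y 0) P P)
    (hY_int : Integrable (Y 0) P)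
    (hY_pos : 0 < ∫ ω, Y 0 ω ∂P)
    (hR_le : R ≤ mΩ)
    (hR_indep : Indep R (⨆ i, MeasurableSpace.comap (Y i) inferInstance) P)
    (p : ℝ → ℝ) (hp : StrictMonoOn p (Set.Ici 0))
    (hp_int : Integrable (fun ω => ∫ s in (0 : ℝ)..(Y 0 ω + Y 1 ω), p s) P)
    (a₀ : ℝ) (ha₀ : 0 ≤ a₀) (k : ℕ) :
    AoI.IsOptimal R P p a₀ Y (AoI.Policy.ofSampling (AoI.whittleSampling P p a₀ Y k)) ∧
    ∃ β : ℝ,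
      AoI.IsThresholdRoot P p Y k β ∧
      (∀ β' : ℝ, AoI.IsThresholdRoot P p Y k β' → β' = β) ∧
      AoI.cost P p a₀ Y (AoI.Policy.ofSampling (AoI.whittleSampling P p a₀ Y k)) = (β : EReal) ∧
      (∀ δ : ℝ, 0 ≤ δ →
        (0 ≤ AoI.whittleIndex P p Y k δ 0 ↔ β ≤ AoI.meanPenalty P p (Y (k + 1)) δ)) ∧
      (∀ i ω, AoI.whittleSampling P p a₀ Y k i ω = AoI.thresholdSampling P p Y β i ω) := by
  have M : AoI.ServiceModel R P Y (P.map (Y 0)) :=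
    ⟨hY_meas, hY_nonneg, hY_indep, fun i => (hY_ident i).map_eq, hR_le, hR_indep⟩
  have := M.isProbabilityMeasure
  -- Extending `p` by `p 0` to negative arguments makes it monotone on the whole line, hence
  -- integrable on every bounded interval; only nonnegative ages ever occur.
  have h := AoI.penaltyModel_extend M hY_int hY_pos hp hp_int
  have hp₀ : ∀ s, 0 ≤ s → p s = p (max s 0) := fun s hs => by rw [max_eq_left hs]
  obtain ⟨β, hβ, hroot⟩ := h.exists_thresholdExcess_eq_zero
  have hSeq : AoI.whittleSampling P p a₀ Y k = AoI.thresholdSampling P p Y β :=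
    funext fun i => funext fun ω => M.whittleSampling_eq h hp₀ hβ hroot k i ω
  have hS := M.waitsUntil_thresholdSampling h hp₀ hβ
  rw [hSeq]
  have hA := M.admissible_ofSampling hS
  have hcost : AoI.cost P p a₀ Y (AoI.Policy.ofSampling (AoI.thresholdSampling P p Y β))
      = (β : EReal) :=
    le_antisymm (M.cost_le hA h hp₀ ha₀ hβ hroot (fun _ _ => rfl) fun i ω => by
      rw [sub_eq_iff_eq_add']; exact hS.succ i ω) (M.le_cost hA h hp₀ ha₀ hβ hroot)
  refine ⟨⟨hA, fun π' hπ' => hcost.trans_le (M.le_cost hπ' h hp₀ ha₀ hβ hroot)⟩, β,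
    (M.isThresholdRoot_iff h hp₀ k).2 ⟨hβ, hroot⟩, fun β' hβ' => ?_, hcost, fun δ hδ => ?_,
    fun _ _ => rfl⟩
  · obtain ⟨h1, h2⟩ := (M.isThresholdRoot_iff h hp₀ k).1 hβ'
    exact h.thresholdExcess_root_unique hβ h1 hroot h2
  · rw [M.whittleIndex_nonneg_iff h hp₀ hβ hroot k hδ, M.meanPenalty_eq h.mono hp₀ _ hδ]
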